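/- Let $Y$ be a complex manifold of dimension $d$ with a holomorphic volume form $\Omega$ (a nowhere vanishing holomorphic $d$-form), and let $\iota:M\hookrightarrow Y$ be a compact embedded real submanifold of real dimension $d$ such that $\iota^*\Omega$ is a (real, nowhere vanishing) volume form; orient $M$ by it. Let $n\ge 0$. Write $\mathrm{T}^*\mathbf{G}_n\mathcal H=\{q\in B(\mathcal H): q^2=q,\ \operatorname{rank} q=n\}$ for the cotangent bundle of the Grassmannian of $n$-planes in a Hilbert space $\mathcal H$, a complex submanifold of $B(\mathcal H)$ whose zero section consists of the orthogonal projections. (1) A *Hermitian quantization of points* of rank $n$ is a separable complex Hilbert space $\mathcal H$ with a holomorphic map $q:Y\to \mathrm{T}^*\mathbf{G}_n\mathcal H\subset B(\mathcal H)$ such that $q(x)$ is self-adjoint for all $x\in M$ and, for some constant $c>0$ (a rescaling of $\Omega$), $\langle\Psi_1,\Psi_2\rangle=c\int_M\langle\Psi_1,q\Psi_2\rangle\,\Omega$ for all $\Psi_1,\Psi_2\in\mathcal H$. A morphism $(\mathcal H,q)\to(\mathcal H',q')$ is a unitary $U:\mathcal H\to\mathcal H'$ with $q'=UqU^*$. The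 three-point function is $\Delta(y_1,y_2,y_3)=\frac1n\operatorname{Tr}(q(y_3)q(y_2)q(y_1))$ (set to be $0$ if $n=0$). (2) A *Hermitian propagator* of rank $n$ is a holomorphic vector bundle $\mathcal E\to Y$ of rank $n$ with a smooth Hermitian metric and a holomorphic section $P$ of $\mathcal E^*\boxtimes\mathcal E\to Y\times Y$, i.e. a holomorphic family of linear maps $P(x,y):\mathcal E_x\to\mathcal E_y$, written $v\mapsto vP(x,y)$, such that $P(x,x)=\mathbb 1$ and $|P(x,\cdot)|,|P(\cdot,x)|\in L^2(M,\Omega)$ for all $x\in Y$; for some constant $c>0$, $c\int_M P(x,z)P(z,y)\,\Omega_z=P(x,y)$ for all $x,y\in Y$; and $P(x,y)=P(y,x)^*$ for all $x,y\in M$. A morphism $(\mathcal E,P)\to(\mathcal E',P')$ is a holomorphic vector bundle isomorphism $f:\mathcal E\to\mathcal E'$ over $\mathrm{id}_Y$ that is unitary on the fibres over $M$ and satisfies $f(v)P'(x,y)=f(vP(x,y))$ for all $x,y\in Y$ and $v\in\mathcal E_x$. The three-point function is $\Delta(y_1,y_2,y_3)=\frac1n\operatorname{Tr}(P(y_1,y_2)P(y_2,y_3)P(y_3,y_1))$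 (set to be $0$ if $n=0$). Then there is an equivalence between the categories (1) and (2) such that the equivalence and its inverse preserve $\Delta$. Moreover, if $P$ corresponds to $q$ under this equivalence, then (a) $q$ is injective if and only if for all $x\neq y$ in $Y$ there are $w,z\in Y$ with $P(w,x)P(x,z)\neq P(w,y)P(y,z)$; hence the equivalence restricts to one between the injective quantizations and the propagators with this property; (b) the ranges of $q(x)$ and $q(y)$ intersect only in $0$ for all $x\ne y$ in $Y$ if and only if for all $x\neq y$ in $Y$ and all nonzero $v_x\in\mathcal E_x$, $v_y\in\mathcal E_y$ there is $z\in Y$ with $v_xP(x,z)\neq v_yP(y,z)$; the equivalence restricts likewise. -/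

import Mathlib

open scoped Manifold ContDiff Bundle InnerProductSpace
open CategoryTheory MeasureTheory

universe u v w

noncomputable section

/-! ### Complex manifolds with a holomorphic volume form, and cycles of integration

Complex manifolds of dimension `d` are modelled on `ℂᵈ`, with analytic (`C^ω` over `ℂ`)
transition maps; "holomorphic" is expressed as `ContMDiff … ω` over `ℂ`. -/

/-- The model space of a complex manifold of dimension `d`. -/
abbrev CModel (d : ℕ) : Type := EuclideanSpace ℂ (Fin d)

/-- The model space of a real manifold of dimension `d`. -/
abbrev RModel (d : ℕ) : Type := EuclideanSpace ℝ (Fin d)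

/-- A holomorphic volume form on a complex manifold of dimension `d`: a nowhere vanishing
holomorphic form of degree `d`. It is holomorphic if in every chart `φ` the coefficient of
`dz₁ ∧ … ∧ dz_d` is a holomorphic function on the target of `φ`. -/
structure HolomorphicVolumeForm (d : ℕ) (Y : Type*) [TopologicalSpace Y]
    [ChartedSpace (CModel d) Y] where
  /-- The value of the form at a point. -/
  form : ∀ y : Y, TangentSpace 𝓘(ℂ, CModel d) y [⋀^Fin d]→L[ℂ] ℂ
  holomorphic : ∀ y₀ : Y, ContDiffOn ℂ ω
    (fun z : CModel d => form ((chartAt (CModel d) y₀).symm z)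
      (fun i => mfderiv 𝓘(ℂ, CModel d) 𝓘(ℂ, CModel d) (chartAt (CModel d) y₀).symm z
        (EuclideanSpace.single i (1 : ℂ))))
    (chartAt (CModel d) y₀).target
  ne_zero : ∀ y, form y ≠ 0

section Cycle

variable {d : ℕ} {Y : Type*} [TopologicalSpace Y] [ChartedSpace (CModel d) Y]
  {M : Type*} [TopologicalSpace M] [ChartedSpace (RModel d) M]

/-- The pullback `ι^*Ω` of a holomorphic volume form along a map `ι` from a real manifold:
a complex valued form of degree `d`, evaluated on `d` tangent vectors at `x`. (The real and the
complex tangent space of `Y` at a point are the same space, with its real and its complex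
structure.) -/
def HolomorphicVolumeForm.pullback (Ω : HolomorphicVolumeForm d Y) (ι : M → Y) (x : M)
    (v : Fin d → TangentSpace 𝓘(ℝ, RModel d) x) : ℂ :=
  Ω.form (ι x) (fun i => mfderiv 𝓘(ℝ, RModel d) 𝓘(ℝ, CModel d) ι x (v i))

/-- `ι : M → Y` is a (smoothly embedded) real submanifold of real dimension `d = dim_ℂ Y`, and
`ι^*Ω` is a volume form on it, i.e. real valued and nowhere vanishing. -/
structure IsVolumeCycle (Ω : HolomorphicVolumeForm d Y) (ι : M → Y) : Prop where
  embedding : Manifold.IsSmoothEmbedding 𝓘(ℝ, RModel d) 𝓘(ℝ, CModel d) ∞ ι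
  real : ∀ x v, (Ω.pullback ι x v).im = 0
  ne_zero : ∀ x, ∃ v, Ω.pullback ι x v ≠ 0

/-- The absolute value of the coefficient of `ι^*Ω` with respect to `dx₁ ∧ … ∧ dx_d` in the chart
of `M` at `p`, as a function on the target of that chart. -/
def HolomorphicVolumeForm.chartDensity (Ω : HolomorphicVolumeForm d Y) (ι : M → Y) (p : M)
    (z : RModel d) : ℝ :=
  ‖Ω.form (ι ((chartAt (RModel d) p).symm z))
    (fun i => mfderiv 𝓘(ℝ, RModel d) 𝓘(ℝ, CModel d) (ι ∘ (chartAt (RModel d) p).symm) z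
      (EuclideanSpace.single i (1 : ℝ)))‖

variable (M) in
/-- A smooth partition of unity on a compact manifold, subordinate to the chart domains. -/
def chartPartition [IsManifold 𝓘(ℝ, RModel d) ∞ M] [T2Space M] [CompactSpace M] :
    SmoothPartitionOfUnity M 𝓘(ℝ, RModel d) M Set.univ :=
  Classical.choose
    (SmoothPartitionOfUnity.exists_isSubordinate_chartAt_source 𝓘(ℝ, RModel d) M)

variable (M) in
theorem chartPartition_isSubordinate [IsManifold 𝓘(ℝ, RModel d) ∞ M] [T2Space M]
    [CompactSpace M] :
    (chartPartition (d := d) M).IsSubordinate (fun x => (chartAt (RModel d) x).source) :=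
  Classical.choose_spec
    (SmoothPartitionOfUnity.exists_isSubordinate_chartAt_source 𝓘(ℝ, RModel d) M)

/-- Integration of functions against the volume form `ι^*Ω` on the compact manifold `M`, which is
given the orientation defined by `ι^*Ω`: the integral of `f` is the sum over a partition of unity
`ρ` of the integrals of `ρ_p f |∂(ι^*Ω)/∂(x₁, …, x_d)|` over the chart at `p`. -/
def HolomorphicVolumeForm.measure [IsManifold 𝓘(ℝ, RModel d) ∞ M] [T2Space M] [CompactSpace M]
    [MeasurableSpace M] (Ω : HolomorphicVolumeForm d Y) (ι : M → Y) : Measure M :=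
  Measure.sum fun p : M =>
    (((volume : Measure (RModel d)).restrict (chartAt (RModel d) p).target).withDensity
      (fun z => ENNReal.ofReal
        (chartPartition (d := d) M p ((chartAt (RModel d) p).symm z) * Ω.chartDensity ι p z))).map
      (chartAt (RModel d) p).symm

end Cycle

/-! ### The cotangent bundle of the Grassmannian, and quantizations of points -/

/-- The cotangent bundle `T^*G_n H` of the Grassmannian of `n`-dimensional subspaces of a Hilbert
space, realized in `B(H)` as the set of all (not necessarily orthogonal) projections of rank `n`.
The zero section `G_n H` consists of the self-adjoint ones. The complex structure is that of a
complex submanifold of `B(H)`. -/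
def cotangentGrassmannian (n : ℕ) (H : Type*) [NormedAddCommGroup H] [InnerProductSpace ℂ H] :
    Set (H →L[ℂ] H) :=
  {q | IsIdempotentElem q ∧ LinearMap.rank (q : H →ₗ[ℂ] H) = n}

/-- The trace of an operator of finite rank: the trace of its restriction to its range. -/
def finiteRankTrace {H : Type*} [NormedAddCommGroup H] [InnerProductSpace ℂ H]
    (T : H →L[ℂ] H) : ℂ :=
  LinearMap.trace ℂ (LinearMap.range (T : H →ₗ[ℂ] H))
    ((T : H →ₗ[ℂ] H).rangeRestrict ∘ₗ (LinearMap.range (T : H →ₗ[ℂ] H)).subtype)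

section Categories

variable {d : ℕ} {Y : Type u} [TopologicalSpace Y] [ChartedSpace (CModel d) Y]
  {M : Type v} [TopologicalSpace M] [ChartedSpace (RModel d) M]
  [IsManifold 𝓘(ℝ, RModel d) ∞ M] [T2Space M] [CompactSpace M] [MeasurableSpace M]

/-- A Hermitian (holomorphic) quantization of points of rank `n` of `(Y, Ω)` with respect to the
cycle `ι : M → Y`: a holomorphic map `q : Y → T^*G_n H ⊆ B(H)` for a separable Hilbert space `H`,
which maps `M` into the zero section, and for which `1 = ∫_M q Ω` weakly, up to rescaling `Ω` by
a constant. -/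
structure PointQuantization (Ω : HolomorphicVolumeForm d Y) (ι : M → Y) (n : ℕ) where
  /-- The Hilbert space. -/
  H : Type w
  [normed : NormedAddCommGroup H]
  [inner : InnerProductSpace ℂ H]
  [complete : CompleteSpace H]
  [separable : TopologicalSpace.SeparableSpace H]
  /-- The quantization map. -/
  q : Y → H →L[ℂ] H
  mem : ∀ y, q y ∈ cotangentGrassmannian n H
  holomorphic : ContMDiff 𝓘(ℂ, CModel d) 𝓘(ℂ, H →L[ℂ] H) ω q
  hermitian : ∀ x, IsSelfAdjoint (q (ι x))
  overcomplete : ∃ c : ℝ, 0 < c ∧ ∀ ψ₁ ψ₂ : H,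
    ⟪ψ₁, ψ₂⟫_ℂ = (c : ℂ) * ∫ x, ⟪ψ₁, q (ι x) ψ₂⟫_ℂ ∂(Ω.measure ι)

namespace PointQuantization

attribute [instance] normed inner complete separable

variable {Ω : HolomorphicVolumeForm d Y} {ι : M → Y} {n : ℕ}

/-- Morphisms of quantizations of points: unitary equivalences `U` of the Hilbert spaces that
carry `q` to `q' = U q U^*`. -/
@[ext]
structure Hom (Q Q' : PointQuantization.{u, v, w} Ω ι n) where
  /-- The unitary equivalence. -/
  U : Q.H ≃ₗᵢ[ℂ] Q'.H
  conj : ∀ y ψ, Q'.q y (U ψ) = U (Q.q y ψ)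

instance : Category (PointQuantization.{u, v, w} Ω ι n) where
  Hom := Hom
  id Q := ⟨LinearIsometryEquiv.refl ℂ Q.H, fun _ _ => rfl⟩
  comp f g := ⟨f.U.trans g.U, fun y ψ => by
    simp [g.conj, f.conj]⟩
  id_comp _ := Hom.ext (by ext; rfl)
  comp_id _ := Hom.ext (by ext; rfl)
  assoc _ _ _ := Hom.ext (by ext; rfl)

/-- The three-point function `Δ(y₁, y₂, y₃) = Tr(q(y₃) q(y₂) q(y₁))`, for the trace normalized so
that projections of rank `n` have trace one. -/
def threePoint (Q : PointQuantization.{u, v, w} Ω ι n) (y₁ y₂ y₃ : Y) : ℂ :=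
  (n : ℂ)⁻¹ * finiteRankTrace (Q.q y₃ * Q.q y₂ * Q.q y₁)

end PointQuantization

/-! ### Holomorphic vector bundles with a Hermitian metric and a Hermitian propagator -/

/-- The operator norm of a linear map between complex vector spaces with inner products `h`
and `k`. -/
def coreOpNorm {V W : Type*} [AddCommGroup V] [Module ℂ V] [AddCommGroup W] [Module ℂ W]
    (h : InnerProductSpace.Core ℂ V) (k : InnerProductSpace.Core ℂ W) (T : V →ₗ[ℂ] W) : ℝ :=
  sSup {r : ℝ | ∃ v : V, (h.inner v v).re ≤ 1 ∧ r = Real.sqrt (k.inner (T v) (T v)).re}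

/-- A holomorphic vector bundle `E → Y` of rank `n` with a (smooth) Hermitian metric and a Hermitian
propagator `P` with respect to the cycle `ι : M → Y`. The propagator is a holomorphic section of
`E^* ⊠ E → Y × Y`, i.e. a family of linear maps `P x y : E x → E y` that depends holomorphically on
`(x, y)`; the product `P(x, z) P(z, y)` of the convolution algebra is the composition
`P z y ∘ P x z`. -/
structure HermitianPropagator (Ω : HolomorphicVolumeForm d Y) (ι : M → Y) (n : ℕ) where
  /-- The fibres of the bundle. -/
  E : Y → Type w
  [addCommGroup : ∀ y, AddCommGroup (E y)]
  [module : ∀ y, Module ℂ (E y)]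
  [topology : ∀ y, TopologicalSpace (E y)]
  [totalTopology : TopologicalSpace (Bundle.TotalSpace (CModel n) E)]
  [fiberBundle : FiberBundle (CModel n) E]
  [vectorBundle : VectorBundle ℂ (CModel n) E]
  [holomorphicBundle : ContMDiffVectorBundle ω (CModel n) E 𝓘(ℂ, CModel d)]
  /-- The Hermitian metric. -/
  metric : ∀ y, InnerProductSpace.Core ℂ (E y)
  /-- The coefficients of the metric in local holomorphic frames are smooth. -/
  metric_smooth : ∀ (y₀ : Y) (a b : CModel n), ContMDiffOn 𝓘(ℝ, CModel d) 𝓘(ℝ, ℂ) ∞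
    (fun y => (metric y).inner ((trivializationAt (CModel n) E y₀).symm y a)
      ((trivializationAt (CModel n) E y₀).symm y b))
    (trivializationAt (CModel n) E y₀).baseSet
  /-- The propagator. -/
  P : ∀ x y, E x →L[ℂ] E y
  /-- `P` is holomorphic on `Y × Y`, in local holomorphic frames. -/
  holomorphic : ∀ x₀ y₀ : Y, ContMDiffAt (𝓘(ℂ, CModel d).prod 𝓘(ℂ, CModel d))
    𝓘(ℂ, CModel n →L[ℂ] CModel n) ω
    (fun p : Y × Y => ContinuousLinearMap.inCoordinates (CModel n) E (CModel n) E
      x₀ p.1 y₀ p.2 (P p.1 p.2)) (x₀, y₀)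
  normalized : ∀ x (v : E x), P x x v = v
  squareIntegrable_right : ∀ x, MemLp
    (fun z => coreOpNorm (metric x) (metric (ι z)) (P x (ι z) : E x →ₗ[ℂ] E (ι z))) 2 (Ω.measure ι)
  squareIntegrable_left : ∀ x, MemLp
    (fun z => coreOpNorm (metric (ι z)) (metric x) (P (ι z) x : E (ι z) →ₗ[ℂ] E x)) 2 (Ω.measure ι)
  /-- `P` is an idempotent for the convolution over `M`, up to rescaling `Ω` by a constant; the
  integral is one of functions with values in the finite-dimensional space `E y`, tested against
  its linear functionals. -/
  idempotent : ∃ c : ℝ, 0 < c ∧ ∀ (x y : Y) (v : E x) (ℓ : E y →ₗ[ℂ] ℂ),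
    (c : ℂ) * ∫ z, ℓ (P (ι z) y (P x (ι z) v)) ∂(Ω.measure ι) = ℓ (P x y v)
  /-- `P` is Hermitian: `P(x, y) = P(y, x)^*` for `x, y ∈ M`. -/
  hermitian : ∀ (x y : M) (v : E (ι x)) (w : E (ι y)),
    (metric (ι y)).inner (P (ι x) (ι y) v) w = (metric (ι x)).inner v (P (ι y) (ι x) w)

namespace HermitianPropagator

attribute [instance] addCommGroup module topology totalTopology fiberBundle vectorBundle
  holomorphicBundle

variable {Ω : HolomorphicVolumeForm d Y} {ι : M → Y} {n : ℕ}

/-- Morphisms of Hermitian propagators: holomorphic vector bundle isomorphisms `f` over `Y` that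
carry `P` to `P'(x, y) = f P(x, y) f⁻¹`, and are unitary on the fibres over `M` (so that
`f⁻¹ = f^*` there). -/
@[ext]
structure Hom (B B' : HermitianPropagator.{u, v, w} Ω ι n) where
  /-- The isomorphisms of the fibres. -/
  f : ∀ y, B.E y ≃ₗ[ℂ] B'.E y
  holomorphic : ContMDiff (𝓘(ℂ, CModel d).prod 𝓘(ℂ, CModel n))
    (𝓘(ℂ, CModel d).prod 𝓘(ℂ, CModel n)) ω
    (fun p : Bundle.TotalSpace (CModel n) B.E =>
      (⟨p.1, f p.1 p.2⟩ : Bundle.TotalSpace (CModel n) B'.E))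
  unitary : ∀ (x : M) (v w : B.E (ι x)),
    (B'.metric (ι x)).inner (f (ι x) v) (f (ι x) w) = (B.metric (ι x)).inner v w
  conj : ∀ x y (v : B.E x), B'.P x y (f x v) = f y (B.P x y v)

instance : Category (HermitianPropagator.{u, v, w} Ω ι n) where
  Hom := Hom
  id B := ⟨fun y => LinearEquiv.refl ℂ (B.E y), contMDiff_id, fun _ _ _ => rfl, fun _ _ _ => rfl⟩
  comp f g := ⟨fun y => (f.f y).trans (g.f y), g.holomorphic.comp f.holomorphic,
    fun x v w => by simp [g.unitary, f.unitary], fun x y v => by simp [g.conj, f.conj]⟩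
  id_comp _ := Hom.ext (by ext; rfl)
  comp_id _ := Hom.ext (by ext; rfl)
  assoc _ _ _ := Hom.ext (by ext; rfl)

/-- The three-point function `Δ(y₁, y₂, y₃) = Tr(P(y₁, y₂) P(y₂, y₃) P(y₃, y₁))`, the normalized
trace of an endomorphism of the fibre over `y₁`. -/
def threePoint (B : HermitianPropagator.{u, v, w} Ω ι n) (y₁ y₂ y₃ : Y) : ℂ :=
  (n : ℂ)⁻¹ * LinearMap.trace ℂ (B.E y₁)
    ((B.P y₃ y₁ : B.E y₃ →ₗ[ℂ] B.E y₁) ∘ₗ (B.P y₂ y₃ : B.E y₂ →ₗ[ℂ] B.E y₃) ∘ₗ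
      (B.P y₁ y₂ : B.E y₁ →ₗ[ℂ] B.E y₂))

/-- The propagator separates points: for `x ≠ y` there are `w, z` such that
`P(w, x) P(x, z) ≠ P(w, y) P(y, z)`. -/
def SeparatesPoints (B : HermitianPropagator.{u, v, w} Ω ι n) : Prop :=
  ∀ x y : Y, x ≠ y → ∃ (w z : Y) (v : B.E w), B.P x z (B.P w x v) ≠ B.P y z (B.P w y v)

/-- The propagator separates vectors: for `x ≠ y` and nonzero `v_x ∈ E x`, `v_y ∈ E y` there is a
`z` such that `v_x P(x, z) ≠ v_y P(y, z)`. -/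
def SeparatesVectors (B : HermitianPropagator.{u, v, w} Ω ι n) : Prop :=
  ∀ x y : Y, x ≠ y → ∀ (v : B.E x) (v' : B.E y), v ≠ 0 → v' ≠ 0 → ∃ z, B.P x z v ≠ B.P y z v'

end HermitianPropagator

end Categories

end

/-!
The two categories are related by the tautological bundle. A holomorphic family `q` of projections
of rank `n` defines a holomorphic bundle with fibres `E y = range (q y)`, with the metric of the
Hilbert space, and the restricted projections `P(x, y) = q y : E x → E y` form a Hermitian
propagator: idempotency is the overcompleteness relation `1 = c ∫ q Ω`, and `P(x, y) = P(y, x)^*`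
over `M` because the projections are orthogonal there. All of `Δ` and the conditions on
injectivity and on ranges translate directly, because the vectors in the ranges of the `q x` with
`x ∈ M` span a dense subspace (`PointQuantization.dense_fiber`).

The functor defined in this way is fully faithful: a morphism of propagators preserves the Gram
matrix of the vectors in the ranges of the `q x`, `x ∈ M`, since `⟨v, w⟩ = ⟨v, w P(y, x)⟩` for
`v ∈ E x`, and hence extends to a unitary map of the Hilbert spaces
(`exists_linearIsometryEquiv_of_inner_eq`).

It is essentially surjective: given a propagator `P`, take for the Hilbert space the sections of
`E` spanned by the sections `v P(x, ·)`, with the `L²` inner product over `M`. By idempotency it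
has the reproducing property `⟨v P(x, ·), s⟩ = ⟨v, s(x)⟩` for `x ∈ M`
(`HermitianPropagator.inner_kernelSection`), and `q(y) s = s(y) P(y, ·)` is the quantization. The
compactness of `M` makes this space finite-dimensional: an orthonormal family `ψ_i` satisfies
`∑ |ψ_i(z)|² ≤ n` for `z ∈ M`, and the integral of the left side is the number of its members
(`HermitianPropagator.finiteDimensional_sections`). Hence a section, or an operator, depends
holomorphically on parameters as soon as finitely many of its matrix elements do
(`contMDiffAt_of_inner`), and these are given by `P`.

No property of the measure `Ω.measure ι` enters other than its finiteness for `n > 0`, which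
follows from the idempotency or the overcompleteness relation
(`isFiniteMeasure_of_integral_ne_zero`).
-/

noncomputable section

/-! ### Preliminaries on measures, inner products and traces -/

/-- If every point of a compact space is a non-zero of some continuous function whose integral is
not zero, then the measure is finite. (A function with non-zero integral is integrable, because
the integral of a function that is not integrable is zero by convention.) -/
theorem isFiniteMeasure_of_integral_ne_zero {M : Type*} [TopologicalSpace M] [CompactSpace M]
    [MeasurableSpace M] {μ : Measure M}
    (h : ∀ x, ∃ f : M → ℂ, Continuous f ∧ f x ≠ 0 ∧ ∫ z, f z ∂μ ≠ 0) : IsFiniteMeasure μ := by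
  refine ⟨isCompact_univ.measure_lt_top_of_nhdsWithin fun x _ => ?_⟩
  obtain ⟨f, hf, hx, hint⟩ := h x
  have hi : Integrable f μ := not_imp_comm.1 integral_undef hint
  have hpos : 0 < ‖f x‖ / 2 := half_pos (norm_pos_iff.2 hx)
  refine ⟨{z | ‖f x‖ / 2 ≤ ‖f z‖}, ?_, hi.measure_norm_ge_lt_top hpos⟩
  rw [nhdsWithin_univ]
  filter_upwards [hf.norm.continuousAt.eventually (lt_mem_nhds (half_lt_self (norm_pos_iff.2 hx)))]
    with z hz using le_of_lt hz

/-- Parseval's identity in an orthonormal basis of a finite-dimensional space, for an inner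
product that need not be compatible with a topology given on the space. -/
theorem InnerProductSpace.Core.exists_parseval {V : Type*} [AddCommGroup V] [Module ℂ V]
    [FiniteDimensional ℂ V] (h : InnerProductSpace.Core ℂ V) :
    ∃ e : Fin (Module.finrank ℂ V) → V, (∀ i, h.inner (e i) (e i) = 1) ∧
      ∀ u, (h.inner u u).re = ∑ i, ‖h.inner (e i) u‖ ^ 2 := by
  let _ : NormedAddCommGroup V := h.toNormedAddCommGroup
  let _ : InnerProductSpace ℂ V := InnerProductSpace.ofCore h.toCore
  refine ⟨stdOrthonormalBasis ℂ V, fun i => ?_, fun u => ?_⟩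
  · have := (stdOrthonormalBasis ℂ V).inner_eq_one i
    exact this
  · have h1 := (stdOrthonormalBasis ℂ V).sum_sq_norm_inner_right u
    have h2 : (⟪u, u⟫_ℂ).re = ‖u‖ ^ 2 := by
      simpa using inner_self_eq_norm_sq (𝕜 := ℂ) u
    exact h2.trans h1.symm

/-- Two families of vectors that have the same Gram matrix and span dense subspaces are related
by a unitary equivalence. -/
theorem exists_linearIsometryEquiv_of_inner_eq {H H' X : Type*} [NormedAddCommGroup H]
    [InnerProductSpace ℂ H] [CompleteSpace H] [NormedAddCommGroup H'] [InnerProductSpace ℂ H']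
    [CompleteSpace H'] (a : X → H) (a' : X → H')
    (ha : (Submodule.span ℂ (Set.range a)).topologicalClosure = ⊤)
    (ha' : (Submodule.span ℂ (Set.range a')).topologicalClosure = ⊤)
    (h : ∀ x y, ⟪a x, a y⟫_ℂ = ⟪a' x, a' y⟫_ℂ) :
    ∃ U : H ≃ₗᵢ[ℂ] H', ∀ x, U (a x) = a' x := by
  have hd : DenseRange (Finsupp.linearCombination ℂ a) := by
    have := Submodule.dense_iff_topologicalClosure_eq_top.2 ha
    rwa [← Finsupp.range_linearCombination] at this
  have hd' : DenseRange (Finsupp.linearCombination ℂ a') := by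
    have := Submodule.dense_iff_topologicalClosure_eq_top.2 ha'
    rwa [← Finsupp.range_linearCombination] at this
  have norm_eq (f : X →₀ ℂ) :
      ‖Finsupp.linearCombination ℂ a' f‖ = ‖Finsupp.linearCombination ℂ a f‖ := by
    have : ⟪Finsupp.linearCombination ℂ a' f, Finsupp.linearCombination ℂ a' f⟫_ℂ =
        ⟪Finsupp.linearCombination ℂ a f, Finsupp.linearCombination ℂ a f⟫_ℂ := by
      simp only [Finsupp.linearCombination_apply, Finsupp.sum_inner, Finsupp.inner_sum,
        inner_smul_left, inner_smul_right, h]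
    rw [norm_eq_sqrt_re_inner (𝕜 := ℂ), norm_eq_sqrt_re_inner (𝕜 := ℂ), this]
  refine ⟨(LinearEquiv.refl ℂ (X →₀ ℂ)).extendOfIsometry (Finsupp.linearCombination ℂ a)
    (Finsupp.linearCombination ℂ a') hd hd' norm_eq, fun x => ?_⟩
  have := LinearEquiv.extendOfIsometry_eq (LinearEquiv.refl ℂ (X →₀ ℂ))
    (Finsupp.linearCombination ℂ a)
    (Finsupp.linearCombination ℂ a') hd hd' norm_eq (Finsupp.single x 1)
  simpa using this

/-- The cyclic invariance of the trace, for the trace of an operator of finite rank that factors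
through a finite-dimensional space. -/
theorem finiteRankTrace_eq_trace_comp {H V : Type*} [NormedAddCommGroup H]
    [InnerProductSpace ℂ H] [AddCommGroup V] [Module ℂ V] [FiniteDimensional ℂ V]
    (T : H →L[ℂ] H) (A : V →ₗ[ℂ] H) (B : H →ₗ[ℂ] V) (hB : Function.Surjective B)
    (hT : ∀ ψ, T ψ = A (B ψ)) : finiteRankTrace T = LinearMap.trace ℂ V (B ∘ₗ A) := by
  have hA : ∀ v, A v ∈ LinearMap.range (T : H →ₗ[ℂ] H) := fun v => by
    obtain ⟨ψ, rfl⟩ := hB v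
    exact ⟨ψ, hT ψ⟩
  have hfin : FiniteDimensional ℂ (LinearMap.range (T : H →ₗ[ℂ] H)) := by
    have : LinearMap.range (T : H →ₗ[ℂ] H) ≤ LinearMap.range A := by
      rintro _ ⟨ψ, rfl⟩
      exact ⟨B ψ, (hT ψ).symm⟩
    exact Submodule.finiteDimensional_of_le this
  rw [finiteRankTrace]
  have h1 : (T : H →ₗ[ℂ] H).rangeRestrict ∘ₗ (LinearMap.range (T : H →ₗ[ℂ] H)).subtype =
      (A.codRestrict _ hA) ∘ₗ (B ∘ₗ (LinearMap.range (T : H →ₗ[ℂ] H)).subtype) := by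
    ext v
    exact hT _
  rw [h1, LinearMap.trace_comp_comm']
  rfl

section Coordinates

variable {E N K : Type*} [NormedAddCommGroup E] [NormedSpace ℂ E] [TopologicalSpace K]
  {I : ModelWithCorners ℂ E K} [TopologicalSpace N] [ChartedSpace K N]
  {H : Type*} [NormedAddCommGroup H] [InnerProductSpace ℂ H] [FiniteDimensional ℂ H]

/-- A map to a finite-dimensional Hilbert space is holomorphic if its inner products with the
vectors of a spanning set are. -/
theorem contMDiffAt_of_inner {F : N → H} {x : N} {S : Set H} (hS : Submodule.span ℂ S = ⊤)
    (h : ∀ ψ ∈ S, ContMDiffAt I 𝓘(ℂ, ℂ) ω (fun y => ⟪ψ, F y⟫_ℂ) x) :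
    ContMDiffAt I 𝓘(ℂ, H) ω F x := by
  have key : ∀ ψ : H, ContMDiffAt I 𝓘(ℂ, ℂ) ω (fun y => ⟪ψ, F y⟫_ℂ) x := fun ψ => by
    have hψ : ψ ∈ Submodule.span ℂ S := hS ▸ Submodule.mem_top
    induction hψ using Submodule.span_induction with
    | mem ψ hψ => exact h ψ hψ
    | zero => simpa using contMDiffAt_const
    | add a b _ _ ha hb => simp only [inner_add_left]; exact ha.add hb
    | smul c a _ ha => simp only [inner_smul_left]; exact contMDiffAt_const.mul ha
  have heq : F = fun y => ∑ i, ⟪stdOrthonormalBasis ℂ H i, F y⟫_ℂ • stdOrthonormalBasis ℂ H i :=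
    funext fun y => ((stdOrthonormalBasis ℂ H).sum_repr' (F y)).symm
  rw [heq]
  exact ContMDiffAt.sum fun i _ => (key _).smul contMDiffAt_const

/-- An operator valued map on a finite-dimensional Hilbert space is holomorphic if its values on
the vectors of a spanning set are. -/
theorem contMDiffAt_clm_of_apply {W : Type*} [NormedAddCommGroup W] [NormedSpace ℂ W]
    {F : N → H →L[ℂ] W} {x : N} {S : Set H} (hS : Submodule.span ℂ S = ⊤)
    (h : ∀ ψ ∈ S, ContMDiffAt I 𝓘(ℂ, W) ω (fun y => F y ψ) x) :
    ContMDiffAt I 𝓘(ℂ, H →L[ℂ] W) ω F x := by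
  have key : ∀ ψ : H, ContMDiffAt I 𝓘(ℂ, W) ω (fun y => F y ψ) x := fun ψ => by
    have hψ : ψ ∈ Submodule.span ℂ S := hS ▸ Submodule.mem_top
    induction hψ using Submodule.span_induction with
    | mem ψ hψ => exact h ψ hψ
    | zero => simpa using contMDiffAt_const
    | add a b _ _ ha hb => simp only [map_add]; exact ha.add hb
    | smul c a _ ha =>
      simp only [map_smul]
      exact (contMDiffAt_const (I := I) (I' := 𝓘(ℂ, ℂ)) (c := c)).smul ha
  have heq : F = fun y => ∑ i, ContinuousLinearMap.smulRightL ℂ H W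
      (innerSL ℂ (stdOrthonormalBasis ℂ H i)) (F y (stdOrthonormalBasis ℂ H i)) := by
    ext y ψ
    conv_lhs => rw [← (stdOrthonormalBasis ℂ H).sum_repr' ψ]
    simp
  rw [heq]
  exact ContMDiffAt.sum fun i _ =>
    ((ContinuousLinearMap.smulRightL ℂ H W (innerSL ℂ (stdOrthonormalBasis ℂ H i))).contMDiff
      |>.contMDiffAt.comp x (key _))

end Coordinates

/-! ### Inner products that are not tied to a topology -/

namespace InnerProductSpace.Core

variable {V : Type*} [AddCommGroup V] [Module ℂ V] (h : InnerProductSpace.Core ℂ V)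

/-- The linear functional `⟨v, ·⟩`. -/
def functional (v : V) : V →ₗ[ℂ] ℂ where
  toFun := h.inner v
  map_add' a b := @InnerProductSpace.Core.inner_add_right ℂ V _ _ _ h.toCore v a b
  map_smul' c a := @InnerProductSpace.Core.inner_smul_right ℂ V _ _ _ h.toCore v a c

@[simp]
theorem functional_apply (v u : V) : h.functional v u = h.inner v u := rfl

/-- The expansion of the inner product of two vectors in terms of a frame. -/
theorem inner_map_eq_sum {n : ℕ} (L : CModel n →ₗ[ℂ] V) (a b : CModel n) :
    h.inner (L a) (L b) = ∑ i, ∑ j, (starRingEnd ℂ) (a i) * b j *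
      h.inner (L (EuclideanSpace.single i 1)) (L (EuclideanSpace.single j 1)) := by
  let _ : NormedAddCommGroup V := h.toNormedAddCommGroup
  let _ : InnerProductSpace ℂ V := InnerProductSpace.ofCore h.toCore
  have hL (a : CModel n) : L a = ∑ i, a i • L (EuclideanSpace.single i 1) := by
    conv_lhs => rw [← (EuclideanSpace.basisFun (Fin n) ℂ).sum_repr a]
    simp
  change ⟪L a, L b⟫_ℂ = ∑ i, ∑ j, (starRingEnd ℂ) (a i) * b j *
    ⟪L (EuclideanSpace.single i 1), L (EuclideanSpace.single j 1)⟫_ℂ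
  rw [hL a, hL b, sum_inner]
  simp only [inner_sum, inner_smul_left, inner_smul_right]
  refine Finset.sum_congr rfl fun i _ => Finset.sum_congr rfl fun j _ => by ring

/-- A space with an inner product is finite-dimensional if the number of elements of orthonormal
families is bounded. Such families are described here by being normalized and satisfying Bessel's
inequality. -/
theorem finiteDimensional_of_bessel (K : ℝ)
    (hK : ∀ (m : ℕ) (ψ : Fin m → V), (∀ i, h.inner (ψ i) (ψ i) = 1) →
      (∀ x, ∑ i, ‖h.inner (ψ i) x‖ ^ 2 ≤ (h.inner x x).re) → (m : ℝ) ≤ K) :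
    FiniteDimensional ℂ V := by
  let _ : NormedAddCommGroup V := h.toNormedAddCommGroup
  let _ : InnerProductSpace ℂ V := InnerProductSpace.ofCore h.toCore
  have hrank : Module.rank ℂ V ≤ (⌊K⌋₊ : ℕ) := by
    refine rank_le fun s hs => Nat.le_floor ?_
    let b := stdOrthonormalBasis ℂ (Submodule.span ℂ (s : Set V))
    have hcard : Module.finrank ℂ (Submodule.span ℂ (s : Set V)) = s.card :=
      finrank_span_finset_eq_card hs
    rw [← hcard]
    have hb : Orthonormal ℂ fun i => (b i : V) :=
      b.orthonormal.comp_linearIsometry (Submodule.subtypeₗᵢ _)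
    refine hK _ (fun i => (b i : V)) (fun i => ?_) fun x => ?_
    · have h1 : ⟪(b i : V), b i⟫_ℂ = 1 := by
        rw [inner_self_eq_norm_sq_to_K, hb.1 i]
        simp
      exact h1
    · have h1 := hb.sum_inner_products_le (x := x) (s := Finset.univ)
      have h2 : (⟪x, x⟫_ℂ).re = ‖x‖ ^ 2 := by simpa using inner_self_eq_norm_sq (𝕜 := ℂ) x
      exact h1.trans_eq h2.symm
  exact Module.rank_lt_aleph0_iff.1 (hrank.trans_lt Cardinal.natCast_lt_aleph0)

/-- A finite-dimensional space with an inner product is isometric to a Euclidean space, which may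
be chosen in any universe. -/
theorem exists_linearEquiv_euclideanSpace [FiniteDimensional ℂ V] :
    ∃ Φ : V ≃ₗ[ℂ] EuclideanSpace ℂ (ULift.{w} (Fin (Module.finrank ℂ V))),
      ∀ s t, ⟪Φ s, Φ t⟫_ℂ = h.inner s t := by
  let _ : NormedAddCommGroup V := h.toNormedAddCommGroup
  let _ : InnerProductSpace ℂ V := InnerProductSpace.ofCore h.toCore
  let b := (stdOrthonormalBasis ℂ V).reindex Equiv.ulift.{w}.symm
  exact ⟨b.repr.toLinearEquiv, fun s t => b.repr.inner_map_map s t⟩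

end InnerProductSpace.Core

theorem coreOpNorm_toCore {V W : Type*} [NormedAddCommGroup V] [InnerProductSpace ℂ V]
    [NormedAddCommGroup W] [InnerProductSpace ℂ W] (T : V →L[ℂ] W) :
    coreOpNorm (InnerProductSpace.toCore : InnerProductSpace.Core ℂ V)
      (InnerProductSpace.toCore : InnerProductSpace.Core ℂ W) (T : V →ₗ[ℂ] W) = ‖T‖ := by
  have hV (v : V) : (⟪v, v⟫_ℂ).re = ‖v‖ ^ 2 := by simpa using inner_self_eq_norm_sq (𝕜 := ℂ) v
  have hW (v : W) : (⟪v, v⟫_ℂ).re = ‖v‖ ^ 2 := by simpa using inner_self_eq_norm_sq (𝕜 := ℂ) v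
  rw [← ContinuousLinearMap.sSup_unitClosedBall_eq_norm, coreOpNorm]
  congr 1
  ext r
  constructor
  · rintro ⟨v, hv, rfl⟩
    change (⟪v, v⟫_ℂ).re ≤ 1 at hv
    refine ⟨v, ?_, ?_⟩
    · rw [hV, sq_le_one_iff₀ (norm_nonneg v)] at hv
      simpa using hv
    · change _ = Real.sqrt (⟪T v, T v⟫_ℂ).re
      rw [hW, Real.sqrt_sq (norm_nonneg _)]
  · rintro ⟨v, hv, rfl⟩
    have hv' : ‖v‖ ≤ 1 := by simpa using hv
    refine ⟨v, ?_, ?_⟩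
    · change (⟪v, v⟫_ℂ).re ≤ 1
      rwa [hV, sq_le_one_iff₀ (norm_nonneg v)]
    · change _ = Real.sqrt (⟪T v, T v⟫_ℂ).re
      rw [hW, Real.sqrt_sq (norm_nonneg _)]

section Quantization

variable {d : ℕ} {Y : Type u} [TopologicalSpace Y] [ChartedSpace (CModel d) Y]
  {M : Type v} [TopologicalSpace M] [ChartedSpace (RModel d) M]
  [IsManifold 𝓘(ℝ, RModel d) ∞ M] [T2Space M] [CompactSpace M] [MeasurableSpace M]
  {Ω : HolomorphicVolumeForm d Y} {ι : M → Y} {n : ℕ}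

/-! ### The tautological bundle of a holomorphic family of projections -/

namespace PointQuantization

variable (Q : PointQuantization.{u, v, w} Ω ι n)

/-- The fibre over `y` of the bundle defined by `q`: the range of the projection `q y`. -/
abbrev Fiber (y : Y) : Type w := LinearMap.range (Q.q y : Q.H →ₗ[ℂ] Q.H)

variable {Q} in
theorem q_fiber {y : Y} (v : Q.Fiber y) : Q.q y v = v := by
  obtain ⟨_, ψ, rfl⟩ := v
  exact DFunLike.congr_fun (Q.mem y).1 ψ

theorem q_q (y : Y) (ψ : Q.H) : Q.q y (Q.q y ψ) = Q.q y ψ :=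
  DFunLike.congr_fun (Q.mem y).1 ψ

theorem finrank_fiber (y : Y) : Module.finrank ℂ (Q.Fiber y) = n := by
  have h : Module.rank ℂ (Q.Fiber y) = n := (Q.mem y).2
  exact Module.finrank_eq_of_rank_eq h

instance finiteDimensional_fiber (y : Y) : FiniteDimensional ℂ (Q.Fiber y) := by
  have h : Module.rank ℂ (Q.Fiber y) = n := (Q.mem y).2
  exact Module.rank_lt_aleph0_iff.1 (h ▸ Cardinal.natCast_lt_aleph0)

/-- The projection `q y` as a map onto its range. -/
def toFiber (y : Y) : Q.H →L[ℂ] Q.Fiber y := (Q.q y).codRestrict _ fun ψ => ⟨ψ, rfl⟩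

theorem toFiber_coe {y : Y} (v : Q.Fiber y) : Q.toFiber y v = v := Subtype.ext (q_fiber v)

/-- A choice of linear coordinates on the fibre over `y₀`. -/
def fiberEquiv (y₀ : Y) : Q.Fiber y₀ ≃L[ℂ] CModel n :=
  ContinuousLinearEquiv.ofFinrankEq (by simp [Q.finrank_fiber])

/-- Coordinates on the fibres near `y₀`: the projection `q y₀` followed by linear coordinates on
its range. -/
def coord (y₀ : Y) : Q.H →L[ℂ] CModel n := (Q.fiberEquiv y₀ : _ →L[ℂ] _) ∘L Q.toFiber y₀

/-- The frame of the fibre over `y₀` that is dual to the coordinates `Q.coord y₀`. -/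
def frame (y₀ : Y) : CModel n →L[ℂ] Q.H :=
  (LinearMap.range (Q.q y₀ : Q.H →ₗ[ℂ] Q.H)).subtypeL ∘L ((Q.fiberEquiv y₀).symm : _ →L[ℂ] _)

/-- The coordinates, at the base point `y₀`, of the projections to the fibre over `y` of the frame
at `y₀`. -/
def transition (y₀ y : Y) : CModel n →L[ℂ] CModel n := Q.coord y₀ ∘L Q.q y ∘L Q.frame y₀

/-- The set of points over which the coordinates at `y₀` trivialize the bundle of ranges. -/
def trivSet (y₀ : Y) : Set Y := {y | IsUnit (Q.transition y₀ y)}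

/-- The frame of the fibre over `y` that is dual to the coordinates at `y₀`, if `y` is close to
`y₀`. -/
def localFrame (y₀ y : Y) : CModel n →L[ℂ] Q.H :=
  Q.q y ∘L Q.frame y₀ ∘L Ring.inverse (Q.transition y₀ y)

theorem contMDiff_transition (y₀ : Y) :
    ContMDiff 𝓘(ℂ, CModel d) 𝓘(ℂ, CModel n →L[ℂ] CModel n) ω (Q.transition y₀) :=
  contMDiff_const.clm_comp (Q.holomorphic.clm_comp contMDiff_const)

theorem isOpen_trivSet (y₀ : Y) : IsOpen (Q.trivSet y₀) :=
  Units.isOpen.preimage (Q.contMDiff_transition y₀).continuous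

theorem mem_trivSet (y₀ : Y) : y₀ ∈ Q.trivSet y₀ := by
  have : Q.transition y₀ y₀ = 1 := by
    ext1 a
    have h : Q.q y₀ (Q.frame y₀ a) = Q.frame y₀ a := q_fiber ((Q.fiberEquiv y₀).symm a)
    have h' : Q.toFiber y₀ (Q.frame y₀ a) = (Q.fiberEquiv y₀).symm a := Q.toFiber_coe _
    simp [transition, coord, h, h']
  rw [trivSet, Set.mem_ofPred_eq, this]
  exact isUnit_one

theorem contMDiffOn_localFrame (y₀ : Y) :
    ContMDiffOn 𝓘(ℂ, CModel d) 𝓘(ℂ, CModel n →L[ℂ] Q.H) ω (Q.localFrame y₀) (Q.trivSet y₀) := by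
  intro y hy
  obtain ⟨a, ha⟩ := id hy
  have h1 : ContMDiffAt 𝓘(ℂ, CModel n →L[ℂ] CModel n) 𝓘(ℂ, CModel n →L[ℂ] CModel n) ω
      Ring.inverse (Q.transition y₀ y) := by
    rw [← ha]
    exact (contDiffAt_ringInverse ℂ a).contMDiffAt
  have h2 := h1.comp y (Q.contMDiff_transition y₀ y)
  exact ((Q.holomorphic y).clm_comp (contMDiffAt_const.clm_comp h2)).contMDiffWithinAt

theorem localFrame_mem (y₀ y : Y) (a : CModel n) :
    Q.localFrame y₀ y a ∈ LinearMap.range (Q.q y : Q.H →ₗ[ℂ] Q.H) := ⟨_, rfl⟩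

theorem coord_localFrame {y₀ y : Y} (hy : y ∈ Q.trivSet y₀) (a : CModel n) :
    Q.coord y₀ (Q.localFrame y₀ y a) = a :=
  DFunLike.congr_fun (Ring.mul_inverse_cancel _ hy) a

/-- The coordinates at `y₀` are injective on nearby fibres, since all fibres have dimension `n`. -/
theorem localFrame_coord {y₀ y : Y} (hy : y ∈ Q.trivSet y₀) (v : Q.Fiber y) :
    Q.localFrame y₀ y (Q.coord y₀ v) = v := by
  let f : Q.Fiber y →ₗ[ℂ] CModel n := (Q.coord y₀ : Q.H →ₗ[ℂ] CModel n) ∘ₗ Submodule.subtype _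
  have hsurj : Function.Surjective f := fun a =>
    ⟨⟨_, Q.localFrame_mem y₀ y a⟩, Q.coord_localFrame hy a⟩
  have hinj : Function.Injective f :=
    (LinearMap.injective_iff_surjective_of_finrank_eq_finrank
      (by simp [Q.finrank_fiber])).2 hsurj
  have : (⟨_, Q.localFrame_mem y₀ y (Q.coord y₀ v)⟩ : Q.Fiber y) = v :=
    hinj (Q.coord_localFrame hy _)
  exact congrArg Subtype.val this

/-- The local trivialization of the bundle of ranges given by the coordinates at `y₀`. -/
def pretriv (y₀ : Y) :
    Bundle.Pretrivialization (CModel n)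
      (Bundle.TotalSpace.proj (F := CModel n) (E := Q.Fiber)) where
  toFun p := (p.1, Q.coord y₀ p.2)
  invFun p := ⟨p.1, ⟨_, Q.localFrame_mem y₀ p.1 p.2⟩⟩
  source := Bundle.TotalSpace.proj ⁻¹' Q.trivSet y₀
  target := Q.trivSet y₀ ×ˢ Set.univ
  map_source' p hp := ⟨hp, trivial⟩
  map_target' p hp := hp.1
  left_inv' := by
    rintro ⟨y, v⟩ hy
    congr 1
    exact Subtype.ext (Q.localFrame_coord hy v)
  right_inv' := by
    rintro ⟨y, a⟩ ⟨hy, -⟩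
    exact Prod.ext rfl (Q.coord_localFrame hy a)
  open_target := (Q.isOpen_trivSet y₀).prod isOpen_univ
  baseSet := Q.trivSet y₀
  open_baseSet := Q.isOpen_trivSet y₀
  source_eq := rfl
  target_eq := rfl
  proj_toFun _ _ := rfl

theorem pretriv_symm {y₀ y : Y} (hy : y ∈ Q.trivSet y₀) (a : CModel n) :
    ((Q.pretriv y₀).symm y a : Q.H) = Q.localFrame y₀ y a := by
  have h := (Q.pretriv y₀).mk_symm hy a
  have h' : Bundle.TotalSpace.mk y ((Q.pretriv y₀).symm y a) =
    Bundle.TotalSpace.mk (F := CModel n) (E := Q.Fiber) y ⟨_, Q.localFrame_mem y₀ y a⟩ := h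
  exact congrArg (fun p : Bundle.TotalSpace (CModel n) Q.Fiber => (p.2 : Q.H)) h'

/-- The holomorphic coordinate changes of the bundle of ranges. -/
theorem exists_coordChange (y₀ y₁ : Y) : ∃ f : Y → CModel n →L[ℂ] CModel n,
    ContMDiffOn 𝓘(ℂ, CModel d) 𝓘(ℂ, CModel n →L[ℂ] CModel n) ω f
      ((Q.pretriv y₀).baseSet ∩ (Q.pretriv y₁).baseSet) ∧
    ∀ y ∈ (Q.pretriv y₀).baseSet ∩ (Q.pretriv y₁).baseSet, ∀ a : CModel n,
      f y a = (Q.pretriv y₁ ⟨y, (Q.pretriv y₀).symm y a⟩).2 := by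
  refine ⟨fun y => Q.coord y₁ ∘L Q.localFrame y₀ y,
    contMDiffOn_const.clm_comp ((Q.contMDiffOn_localFrame y₀).mono Set.inter_subset_left),
    fun y hy a => ?_⟩
  change _ = Q.coord y₁ _
  rw [Q.pretriv_symm hy.1]
  rfl

/-- The holomorphic vector bundle whose fibres are the ranges of the projections `q y`. -/
def prebundle : VectorPrebundle ℂ (CModel n) Q.Fiber where
  pretrivializationAtlas := Set.range Q.pretriv
  pretrivialization_linear' := by
    rintro _ ⟨y₀, rfl⟩
    exact ⟨fun y _ => ⟨fun v w => map_add (Q.coord y₀) _ _, fun c v => map_smul (Q.coord y₀) _ _⟩⟩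
  pretrivializationAt := Q.pretriv
  mem_base_pretrivializationAt := Q.mem_trivSet
  pretrivialization_mem_atlas y₀ := ⟨y₀, rfl⟩
  exists_coordChange := by
    rintro _ ⟨y₀, rfl⟩ _ ⟨y₁, rfl⟩
    obtain ⟨f, hf, h⟩ := Q.exists_coordChange y₀ y₁
    exact ⟨f, hf.continuousOn, h⟩
  totalSpaceMk_isInducing y := by
    have : Q.pretriv y ∘ Bundle.TotalSpace.mk y = fun v => (y, Q.fiberEquiv y v) := by
      funext v
      exact Prod.ext rfl (congrArg (Q.fiberEquiv y) (Q.toFiber_coe v))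
    rw [this]
    exact Topology.isInducing_const_prod.2 (Q.fiberEquiv y).toHomeomorph.isInducing

instance : Q.prebundle.IsContMDiff 𝓘(ℂ, CModel d) ω where
  exists_contMDiffCoordChange := by
    rintro _ ⟨y₀, rfl⟩ _ ⟨y₁, rfl⟩
    exact Q.exists_coordChange y₀ y₁

instance totalSpaceTopology : TopologicalSpace (Bundle.TotalSpace (CModel n) Q.Fiber) :=
  Q.prebundle.totalSpaceTopology

instance fiberBundle : FiberBundle (CModel n) Q.Fiber := Q.prebundle.toFiberBundle

instance vectorBundle : VectorBundle ℂ (CModel n) Q.Fiber := Q.prebundle.toVectorBundle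

instance contMDiffVectorBundle :
    ContMDiffVectorBundle ω (CModel n) Q.Fiber 𝓘(ℂ, CModel d) :=
  Q.prebundle.contMDiffVectorBundle 𝓘(ℂ, CModel d)

theorem trivializationAt_symm {y₀ y : Y} (hy : y ∈ Q.trivSet y₀) (a : CModel n) :
    ((trivializationAt (CModel n) Q.Fiber y₀).symm y a : Q.H) = Q.localFrame y₀ y a :=
  Q.pretriv_symm hy a

section TotalSpace

variable {E N K : Type*} [NormedAddCommGroup E] [NormedSpace ℂ E] [TopologicalSpace K]
  {I : ModelWithCorners ℂ E K} [TopologicalSpace N] [ChartedSpace K N]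

/-- A map to the total space of the bundle of ranges is holomorphic if and only if it is so as a
map to the product of the base and the Hilbert space. -/
theorem contMDiffAt_totalSpace_iff {f : N → Bundle.TotalSpace (CModel n) Q.Fiber} {x : N} :
    ContMDiffAt I (𝓘(ℂ, CModel d).prod 𝓘(ℂ, CModel n)) ω f x ↔
      ContMDiffAt I 𝓘(ℂ, CModel d) ω (fun z => (f z).1) x ∧
      ContMDiffAt I 𝓘(ℂ, Q.H) ω (fun z => ((f z).2 : Q.H)) x := by
  rw [Bundle.contMDiffAt_totalSpace]
  refine and_congr_right fun h => ⟨fun h' => ?_, fun h' => ?_⟩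
  · have hU : Q.trivSet (f x).1 ∈ nhds (f x).1 :=
      (Q.isOpen_trivSet _).mem_nhds (Q.mem_trivSet _)
    have h1 : ContMDiffAt I 𝓘(ℂ, CModel n →L[ℂ] Q.H) ω
        (fun z => Q.localFrame (f x).1 (f z).1) x :=
      ContMDiffAt.comp x ((Q.contMDiffOn_localFrame (f x).1).contMDiffAt hU) h
    refine (h1.clm_apply h').congr_of_eventuallyEq ?_
    filter_upwards [h.continuousAt.eventually_mem hU] with z hz
    exact (Q.localFrame_coord hz (f z).2).symm
  · exact (contMDiffAt_const (c := Q.coord (f x).1)).clm_apply h'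

theorem contMDiff_coe : ContMDiff (𝓘(ℂ, CModel d).prod 𝓘(ℂ, CModel n)) 𝓘(ℂ, Q.H) ω
    (fun p : Bundle.TotalSpace (CModel n) Q.Fiber => (p.2 : Q.H)) := fun p =>
  (Q.contMDiffAt_totalSpace_iff.1 (contMDiffAt_id (x := p))).2

end TotalSpace

end PointQuantization

/-! ### From quantizations of points to Hermitian propagators -/

namespace PointQuantization

variable (Q : PointQuantization.{u, v, w} Ω ι n)

theorem inner_q_left (x : M) (ψ φ : Q.H) : ⟪Q.q (ι x) ψ, φ⟫_ℂ = ⟪ψ, Q.q (ι x) φ⟫_ℂ := by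
  rw [← ContinuousLinearMap.adjoint_inner_right, (Q.hermitian x).adjoint_eq]

variable {Q} in
/-- The projections `q x` with `x ∈ M` separate vectors. -/
theorem eq_zero_of_q_eq_zero {ψ : Q.H} (h : ∀ x, Q.q (ι x) ψ = 0) : ψ = 0 := by
  obtain ⟨c, -, hc⟩ := Q.overcomplete
  have := hc ψ ψ
  simpa [h] using this

/-- The ranges of the projections `q x` with `x ∈ M` span a dense subspace. -/
theorem dense_fiber :
    (Submodule.span ℂ (Set.range fun p : (x : M) × Q.Fiber (ι x) => (p.2 : Q.H))
      ).topologicalClosure = ⊤ := by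
  rw [Submodule.topologicalClosure_eq_top_iff, Submodule.eq_bot_iff]
  refine fun ψ hψ => eq_zero_of_q_eq_zero fun x => ext_inner_left ℂ fun φ => ?_
  rw [inner_zero_right, ← Q.inner_q_left]
  exact hψ _ (Submodule.subset_span ⟨⟨x, Q.toFiber (ι x) φ⟩, rfl⟩)

/-- The overcompleteness relation forces the volume of `M` to be finite: its matrix elements are
continuous functions with non-zero integral. -/
theorem isFiniteMeasure (Q : PointQuantization.{u, v, w} Ω ι n) (hι : Continuous ι) (hn : n ≠ 0) :
    IsFiniteMeasure (Ω.measure ι) := by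
  refine isFiniteMeasure_of_integral_ne_zero fun x => ?_
  have hpos : 0 < Module.finrank ℂ (Q.Fiber (ι x)) := by
    rw [Q.finrank_fiber]
    exact Nat.pos_of_ne_zero hn
  have := Module.nontrivial_of_finrank_pos hpos
  obtain ⟨v, hv⟩ := exists_ne (0 : Q.Fiber (ι x))
  have hv' : ⟪(v : Q.H), v⟫_ℂ ≠ 0 := by simpa using hv
  refine ⟨fun z => ⟪(v : Q.H), Q.q (ι z) v⟫_ℂ, ?_, ?_, ?_⟩
  · exact continuous_const.inner ((Q.holomorphic.continuous.comp hι).clm_apply continuous_const)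
  · simpa only [q_fiber] using hv'
  · obtain ⟨c, -, hc⟩ := Q.overcomplete
    intro h
    exact hv' (by rw [hc, h, mul_zero])

theorem norm_toFiber_le (x : M) : ‖Q.toFiber (ι x)‖ ≤ 1 := by
  refine ContinuousLinearMap.opNorm_le_bound _ zero_le_one fun ψ => ?_
  rw [one_mul]
  change ‖Q.q (ι x) ψ‖ ≤ ‖ψ‖
  have h : ‖Q.q (ι x) ψ‖ ^ 2 ≤ ‖ψ‖ * ‖Q.q (ι x) ψ‖ := by
    have h1 : ⟪Q.q (ι x) ψ, Q.q (ι x) ψ⟫_ℂ = ⟪ψ, Q.q (ι x) ψ⟫_ℂ := by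
      rw [Q.inner_q_left, Q.q_q]
    have h2 := norm_inner_le_norm (𝕜 := ℂ) ψ (Q.q (ι x) ψ)
    rw [← h1, inner_self_eq_norm_sq_to_K] at h2
    simpa using h2
  by_contra! hlt
  nlinarith [norm_nonneg ψ, norm_nonneg (Q.q (ι x) ψ)]

/-- The propagator of a quantization: the restriction of the projection `q y` to the range of
`q x`. -/
def prop (x y : Y) : Q.Fiber x →L[ℂ] Q.Fiber y :=
  Q.toFiber y ∘L (LinearMap.range (Q.q x : Q.H →ₗ[ℂ] Q.H)).subtypeL

theorem norm_prop (x y : Y) :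
    ‖Q.prop x y‖ = ‖Q.q y ∘L (LinearMap.range (Q.q x : Q.H →ₗ[ℂ] Q.H)).subtypeL‖ :=
  ContinuousLinearMap.opNorm_ext _ _ fun _ => rfl

/-- Over `M`, the ranges are projected to orthogonally, so that restricting to them does not
change the norm. -/
theorem norm_prop_left (x : M) (y : Y) : ‖Q.prop (ι x) y‖ = ‖Q.q y ∘L Q.q (ι x)‖ := by
  apply le_antisymm
  · refine ContinuousLinearMap.opNorm_le_bound _ (norm_nonneg _) fun v => ?_
    have h := (Q.q y ∘L Q.q (ι x)).le_opNorm (v : Q.H)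
    rwa [ContinuousLinearMap.comp_apply, q_fiber] at h
  · refine ContinuousLinearMap.opNorm_le_bound _ (norm_nonneg (Q.prop (ι x) y)) fun ψ => ?_
    calc ‖Q.q y (Q.q (ι x) ψ)‖ = ‖Q.prop (ι x) y (Q.toFiber (ι x) ψ)‖ := rfl
      _ ≤ ‖Q.prop (ι x) y‖ * ‖Q.toFiber (ι x) ψ‖ := ContinuousLinearMap.le_opNorm _ _
      _ ≤ ‖Q.prop (ι x) y‖ * ‖ψ‖ := by
        gcongr
        simpa using (Q.toFiber (ι x)).le_of_opNorm_le (Q.norm_toFiber_le x) ψ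

theorem memLp_of_continuous [BorelSpace M] (hι : Continuous ι) (hn : n ≠ 0) {f : M → ℝ}
    (Q : PointQuantization.{u, v, w} Ω ι n) (hf : Continuous f) : MemLp f 2 (Ω.measure ι) := by
  have := Q.isFiniteMeasure hι hn
  exact hf.memLp_of_hasCompactSupport (HasCompactSupport.of_compactSpace f)

/-- The local frames are holomorphic, hence smooth over `ℝ`, and so is their Gram matrix. -/
theorem inner_localFrame_contMDiffOn (y₀ : Y) (a b : CModel n) :
    ContMDiffOn 𝓘(ℝ, CModel d) 𝓘(ℝ, ℂ) ∞
      (fun y => ⟪Q.localFrame y₀ y a, Q.localFrame y₀ y b⟫_ℂ) (Q.trivSet y₀) := by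
  have key (a : CModel n) : ContMDiffOn 𝓘(ℝ, CModel d) 𝓘(ℝ, Q.H) ∞
      (fun y => Q.localFrame y₀ y a) (Q.trivSet y₀) := by
    intro y hy
    have h := (Q.contMDiffOn_localFrame y₀ y hy).clm_apply
      (contMDiffWithinAt_const (c := a))
    rw [contMDiffWithinAt_iff] at h ⊢
    exact ⟨h.1, (h.2.restrict_scalars ℝ).of_le le_top⟩
  intro y hy
  have h := (contDiff_inner (𝕜 := ℂ) (E := Q.H) (n := ∞)).contMDiff.contMDiffAt
    (x := (Q.localFrame y₀ y a, Q.localFrame y₀ y b))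
  exact h.comp_contMDiffWithinAt y ((key a y hy).prodMk_space (key b y hy))

/-- The Hermitian propagator of a quantization of points: `v P(x, y) = q(y) v` on the bundle of
the ranges of `q`, with the metric induced by the Hilbert space. -/
def toPropagator [BorelSpace M] (hι : Continuous ι) : HermitianPropagator.{u, v, w} Ω ι n where
  E := Q.Fiber
  metric y := InnerProductSpace.toCore
  metric_smooth y₀ a b := (Q.inner_localFrame_contMDiffOn y₀ a b).congr fun y hy => by
    change ⟪((trivializationAt (CModel n) Q.Fiber y₀).symm y a : Q.H),
      ((trivializationAt (CModel n) Q.Fiber y₀).symm y b : Q.H)⟫_ℂ = _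
    rw [Q.trivializationAt_symm hy, Q.trivializationAt_symm hy]
  P := Q.prop
  holomorphic x₀ y₀ := by
    have hx : Q.trivSet x₀ ∈ nhds x₀ := (Q.isOpen_trivSet _).mem_nhds (Q.mem_trivSet _)
    have hy : Q.trivSet y₀ ∈ nhds y₀ := (Q.isOpen_trivSet _).mem_nhds (Q.mem_trivSet _)
    have h1 : ContMDiffAt (𝓘(ℂ, CModel d).prod 𝓘(ℂ, CModel d)) 𝓘(ℂ, CModel n →L[ℂ] CModel n) ω
        (fun p : Y × Y => Q.coord y₀ ∘L Q.q p.2 ∘L Q.localFrame x₀ p.1) (x₀, y₀) :=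
      contMDiffAt_const.clm_comp (((Q.holomorphic y₀).comp (x₀, y₀) contMDiffAt_snd).clm_comp
        (ContMDiffAt.comp (x₀, y₀) ((Q.contMDiffOn_localFrame x₀).contMDiffAt hx)
          contMDiffAt_fst))
    refine h1.congr_of_eventuallyEq ?_
    filter_upwards [prod_mem_nhds hx hy] with p hp
    ext1 a
    rw [ContinuousLinearMap.inCoordinates, ContinuousLinearMap.comp_apply,
      ContinuousLinearMap.comp_apply, Bundle.Trivialization.continuousLinearMapAt_apply,
      Bundle.Trivialization.symmL_apply _ hp.1,
      Bundle.Trivialization.coe_linearMapAt_of_mem _ hp.2]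
    change Q.coord y₀ (Q.q p.2 ((trivializationAt (CModel n) Q.Fiber x₀).symm p.1 a : Q.H)) = _
    rw [Q.trivializationAt_symm hp.1]
    rfl
  normalized x v := Q.toFiber_coe v
  squareIntegrable_right x := by
    simp only [coreOpNorm_toCore]
    by_cases hn : n = 0
    · have : Subsingleton (Q.Fiber x) :=
        Module.finrank_zero_iff.1 ((Q.finrank_fiber x).trans hn)
      simp [Subsingleton.elim (Q.prop x _) 0]
    · refine Q.memLp_of_continuous hι hn ?_
      simp only [norm_prop]
      exact ((Q.holomorphic.continuous.comp hι).clm_comp continuous_const).norm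
  squareIntegrable_left x := by
    simp only [coreOpNorm_toCore]
    by_cases hn : n = 0
    · have : Subsingleton (Q.Fiber x) :=
        Module.finrank_zero_iff.1 ((Q.finrank_fiber x).trans hn)
      simp [Subsingleton.elim (Q.prop _ x) 0]
    · refine Q.memLp_of_continuous hι hn ?_
      simp only [norm_prop_left]
      exact (continuous_const.clm_comp (Q.holomorphic.continuous.comp hι)).norm
  idempotent := by
    -- Overcompleteness, tested against the vector that represents the functional `ℓ ∘ q y`.
    obtain ⟨c, hc, h⟩ := Q.overcomplete
    refine ⟨c, hc, fun x y v ℓ => ?_⟩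
    have := h ((InnerProductSpace.toDual ℂ Q.H).symm
      (LinearMap.toContinuousLinearMap ℓ ∘L Q.toFiber y)) v
    simp only [InnerProductSpace.toDual_symm_apply] at this
    exact this.symm
  hermitian x y v w := by
    change ⟪Q.q (ι y) v, (w : Q.H)⟫_ℂ = ⟪(v : Q.H), Q.q (ι x) w⟫_ℂ
    rw [Q.inner_q_left, ← Q.inner_q_left x, q_fiber, q_fiber]

end PointQuantization

/-! ### The functor to propagators, and its properties -/

namespace PointQuantization

namespace Hom

variable {Q Q' : PointQuantization.{u, v, w} Ω ι n} (U : Hom Q Q')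

theorem conj_symm (y : Y) (ψ : Q'.H) : Q.q y (U.U.symm ψ) = U.U.symm (Q'.q y ψ) := by
  rw [LinearIsometryEquiv.eq_symm_apply, ← U.conj, U.U.apply_symm_apply]

/-- The isomorphism of the ranges of `q y` and `q' y = U (q y) U^*` given by `U`. -/
def fiberMap (y : Y) : Q.Fiber y ≃ₗ[ℂ] Q'.Fiber y where
  toFun v := ⟨U.U v, ⟨U.U v, by
    change Q'.q y (U.U v) = _
    rw [U.conj, q_fiber]⟩⟩
  invFun v := ⟨U.U.symm v, ⟨U.U.symm v, by
    change Q.q y (U.U.symm v) = _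
    rw [U.conj_symm, q_fiber]⟩⟩
  map_add' v w := Subtype.ext (map_add U.U (v : Q.H) w)
  map_smul' c v := Subtype.ext (map_smul U.U c (v : Q.H))
  left_inv v := Subtype.ext (U.U.symm_apply_apply _)
  right_inv v := Subtype.ext (U.U.apply_symm_apply _)

/-- The morphism of propagators given by a unitary equivalence of quantizations. -/
def toPropagator [BorelSpace M] (hι : Continuous ι) :
    HermitianPropagator.Hom (Q.toPropagator hι) (Q'.toPropagator hι) where
  f := U.fiberMap
  holomorphic p := by
    refine Q'.contMDiffAt_totalSpace_iff.2 ⟨Bundle.contMDiffAt_proj _, ?_⟩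
    exact (U.U.toContinuousLinearEquiv : Q.H →L[ℂ] Q'.H).contMDiff.contMDiffAt.comp p
      (Q.contMDiff_coe p)
  unitary x (v w : Q.Fiber (ι x)) := U.U.inner_map_map (v : Q.H) w
  conj x y (v : Q.Fiber x) := Subtype.ext (U.conj y v)

end Hom

/-- The functor from quantizations of points to Hermitian propagators. -/
def propagatorFunctor [BorelSpace M] (hι : Continuous ι) :
    PointQuantization.{u, v, w} Ω ι n ⥤ HermitianPropagator.{u, v, w} Ω ι n where
  obj Q := Q.toPropagator hι
  map U := Hom.toPropagator U hι
  map_id _ := rfl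
  map_comp _ _ := rfl

instance [BorelSpace M] (hι : Continuous ι) :
    (propagatorFunctor (Ω := Ω) (n := n) hι).Faithful where
  map_injective {Q Q'} U V h := by
    refine Hom.ext (LinearIsometryEquiv.ext fun ψ => ?_)
    have key (x : M) (v : Q.Fiber (ι x)) : U.U v = V.U v :=
      congrArg (fun f : HermitianPropagator.Hom (Q.toPropagator hι) (Q'.toPropagator hι) =>
        ((show Q'.Fiber (ι x) from f.f (ι x) v) : Q'.H)) h
    have hd := Submodule.dense_iff_topologicalClosure_eq_top.2 Q.dense_fiber
    have := ContinuousLinearMap.ext_on (f := (U.U.toContinuousLinearEquiv : Q.H →L[ℂ] Q'.H))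
      (g := (V.U.toContinuousLinearEquiv : Q.H →L[ℂ] Q'.H)) hd (by
        rintro _ ⟨p, rfl⟩
        exact key p.1 p.2)
    exact DFunLike.congr_fun this ψ

instance [BorelSpace M] (hι : Continuous ι) :
    (propagatorFunctor (Ω := Ω) (n := n) hι).Full where
  map_surjective {Q Q'} g := by
    let f (y : Y) : Q.Fiber y ≃ₗ[ℂ] Q'.Fiber y :=
      HermitianPropagator.Hom.f (B := Q.toPropagator hι) (B' := Q'.toPropagator hι) g y
    have hunitary (x : M) (v w : Q.Fiber (ι x)) :
        ⟪(f (ι x) v : Q'.H), f (ι x) w⟫_ℂ = ⟪(v : Q.H), w⟫_ℂ :=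
      HermitianPropagator.Hom.unitary (B := Q.toPropagator hι) (B' := Q'.toPropagator hι) g x v w
    have hconj (x y : Y) (v : Q.Fiber x) : Q'.q y (f x v) = f y (Q.prop x y v) :=
      congrArg Subtype.val (HermitianPropagator.Hom.conj (B := Q.toPropagator hι)
        (B' := Q'.toPropagator hι) g x y v)
    -- Pairings with vectors in fibres over `M` are given by the metric and the propagator.
    have hinner (x : M) (y : Y) (v : Q.Fiber (ι x)) (w : Q.Fiber y) :
        ⟪(v : Q.H), w⟫_ℂ = ⟪(f (ι x) v : Q'.H), f y w⟫_ℂ := by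
      rw [← q_fiber v, Q.inner_q_left, ← q_fiber (f (ι x) v), Q'.inner_q_left, hconj, hunitary]
      rfl
    obtain ⟨U, hU⟩ := exists_linearIsometryEquiv_of_inner_eq
      (fun p : (x : M) × Q.Fiber (ι x) => (p.2 : Q.H))
      (fun p : (x : M) × Q.Fiber (ι x) => (f _ p.2 : Q'.H)) Q.dense_fiber
      (by
        convert Q'.dense_fiber using 3
        ext ψ
        constructor
        · rintro ⟨p, rfl⟩
          exact ⟨⟨p.1, f _ p.2⟩, rfl⟩
        · rintro ⟨p, rfl⟩
          exact ⟨⟨p.1, (f _).symm p.2⟩, by simp⟩)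
      (fun p p' => hinner p.1 _ p.2 p'.2)
    -- `U` extends `f` on the fibres over `M` by construction; testing against these shows that
    -- it extends `f` on all fibres.
    have hUf (y : Y) (w : Q.Fiber y) : U w = f y w := by
      rw [← sub_eq_zero]
      refine eq_zero_of_q_eq_zero (Q := Q') fun x => ext_inner_left ℂ fun φ => ?_
      obtain ⟨v, hv⟩ := (f (ι x)).surjective (Q'.toFiber (ι x) φ)
      have hv' : Q'.q (ι x) φ = f (ι x) v := congrArg Subtype.val hv.symm
      rw [inner_zero_right, ← Q'.inner_q_left, hv', inner_sub_right, ← hinner,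
        ← show U v = f (ι x) v from hU ⟨x, v⟩, U.inner_map_map, sub_self]
    have hUq (y : Y) : (Q'.q y ∘L (U.toContinuousLinearEquiv : Q.H →L[ℂ] Q'.H)) =
        (U.toContinuousLinearEquiv : Q.H →L[ℂ] Q'.H) ∘L Q.q y := by
      refine ContinuousLinearMap.ext_on
        (Submodule.dense_iff_topologicalClosure_eq_top.2 Q.dense_fiber) ?_
      rintro _ ⟨p, rfl⟩
      change Q'.q y (U p.2) = U (Q.prop (ι p.1) y p.2)
      rw [hUf, hUf, hconj]
    refine ⟨⟨U, fun y ψ => DFunLike.congr_fun (hUq y) ψ⟩, ?_⟩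
    refine HermitianPropagator.Hom.ext (funext fun y => LinearEquiv.ext fun v => ?_)
    exact Subtype.ext (hUf y v)

/-- By cyclicity, `Tr(q(y₃) q(y₂) q(y₁))` is the trace of `q(y₁) q(y₃) q(y₂)` on the range of
`q(y₁)`. -/
theorem threePoint_toPropagator [BorelSpace M]
    (Q : PointQuantization.{u, v, w} Ω ι n) (hι : Continuous ι)
    (y₁ y₂ y₃ : Y) : (Q.toPropagator hι).threePoint y₁ y₂ y₃ = Q.threePoint y₁ y₂ y₃ := by
  rw [threePoint, HermitianPropagator.threePoint]
  congr 1
  refine (finiteRankTrace_eq_trace_comp (Q.q y₃ * Q.q y₂ * Q.q y₁)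
    ((Q.q y₃ * Q.q y₂ : Q.H →ₗ[ℂ] Q.H) ∘ₗ (LinearMap.range (Q.q y₁ : Q.H →ₗ[ℂ] Q.H)).subtype)
    (Q.toFiber y₁ : Q.H →ₗ[ℂ] Q.Fiber y₁)
    (fun v => ⟨v, Q.toFiber_coe v⟩) fun ψ => rfl).symm

/-- Operators that differ can be told apart between vectors in the ranges of projections `q w`
and `q z` with `w, z ∈ M`. -/
theorem injective_iff_separatesPoints [BorelSpace M]
    (Q : PointQuantization.{u, v, w} Ω ι n)
    (hι : Continuous ι) : Function.Injective Q.q ↔ (Q.toPropagator hι).SeparatesPoints := by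
  constructor
  · intro h x y hxy
    by_contra! hne
    refine hxy (h (ContinuousLinearMap.ext_on
      (Submodule.dense_iff_topologicalClosure_eq_top.2 Q.dense_fiber) ?_))
    rintro _ ⟨⟨w, v⟩, rfl⟩
    rw [← sub_eq_zero]
    refine eq_zero_of_q_eq_zero fun z => ?_
    rw [map_sub, sub_eq_zero]
    exact congrArg Subtype.val (hne (ι w) (ι z) v)
  · intro h x y hxy
    by_contra hne
    obtain ⟨w, z, v, hv⟩ := h x y hne
    let v' : Q.Fiber w := v
    refine hv (Subtype.ext ?_)
    change Q.q z (Q.q x v') = Q.q z (Q.q y v')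
    rw [hxy]

/-- A common vector of two ranges cannot be separated from itself, and vectors that are not
separated by the projections `q z` with `z ∈ M` are equal. -/
theorem disjoint_iff_separatesVectors [BorelSpace M]
    (Q : PointQuantization.{u, v, w} Ω ι n)
    (hι : Continuous ι) : (∀ x y, x ≠ y → Disjoint (LinearMap.range (Q.q x : Q.H →ₗ[ℂ] Q.H))
      (LinearMap.range (Q.q y : Q.H →ₗ[ℂ] Q.H))) ↔ (Q.toPropagator hι).SeparatesVectors := by
  constructor
  · intro h x y hxy (v : Q.Fiber x) (v' : Q.Fiber y) hv _
    by_contra! hne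
    have heq : (v : Q.H) = v' := by
      rw [← sub_eq_zero]
      refine eq_zero_of_q_eq_zero fun z => ?_
      rw [map_sub, sub_eq_zero]
      exact congrArg Subtype.val (hne (ι z))
    exact hv (Subtype.ext (Submodule.disjoint_def.1 (h x y hxy) _ v.2 (heq ▸ v'.2)))
  · intro h x y hxy
    refine Submodule.disjoint_def.2 fun ψ hx hy => ?_
    by_contra hψ
    obtain ⟨z, hz⟩ := h x y hxy (⟨ψ, hx⟩ : Q.Fiber x) (⟨ψ, hy⟩ : Q.Fiber y)
      (fun h0 => hψ (congrArg Subtype.val h0)) (fun h0 => hψ (congrArg Subtype.val h0))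
    exact hz rfl

end PointQuantization

/-- The three-point function of a Hermitian propagator is invariant under isomorphisms. -/
theorem HermitianPropagator.Hom.threePoint_eq {B B' : HermitianPropagator.{u, v, w} Ω ι n}
    (f : Hom B B') (y₁ y₂ y₃ : Y) : B.threePoint y₁ y₂ y₃ = B'.threePoint y₁ y₂ y₃ := by
  rw [threePoint, threePoint, ← LinearMap.trace_conj' _ (f.f y₁)]
  congr 2
  ext v
  obtain ⟨v, rfl⟩ := (f.f y₁).surjective v
  simp [LinearEquiv.conj_apply, f.conj]

/-! ### Holomorphic sections of the bundle of a Hermitian propagator -/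

namespace HermitianPropagator

variable (B : HermitianPropagator.{u, v, w} Ω ι n)

/-- Linear coordinates on the fibre over `y`. -/
def fiberEquiv (y : Y) : B.E y ≃L[ℂ] CModel n :=
  (trivializationAt (CModel n) B.E y).continuousLinearEquivAt ℂ y
    (FiberBundle.mem_baseSet_trivializationAt' y)

instance (y : Y) : FiniteDimensional ℂ (B.E y) :=
  (B.fiberEquiv y).symm.toLinearEquiv.finiteDimensional

theorem finrank_fiber (y : Y) : Module.finrank ℂ (B.E y) = n := by
  simp [(B.fiberEquiv y).toLinearEquiv.finrank_eq]

section Holomorphic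

variable {E N K : Type*} [NormedAddCommGroup E] [NormedSpace ℂ E] [TopologicalSpace K]
  {I : ModelWithCorners ℂ E K} [TopologicalSpace N] [ChartedSpace K N]

/-- The image `v P(x, y)` depends holomorphically on `x`, `y` and `v`. -/
theorem contMDiffAt_P {b₁ b₂ : N → Y} {s : ∀ m, B.E (b₁ m)} {m₀ : N}
    (hs : ContMDiffAt I (𝓘(ℂ, CModel d).prod 𝓘(ℂ, CModel n)) ω
      (fun m => (⟨b₁ m, s m⟩ : Bundle.TotalSpace (CModel n) B.E)) m₀)
    (hb₂ : ContMDiffAt I 𝓘(ℂ, CModel d) ω b₂ m₀) :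
    ContMDiffAt I (𝓘(ℂ, CModel d).prod 𝓘(ℂ, CModel n)) ω
      (fun m => (⟨b₂ m, B.P (b₁ m) (b₂ m) (s m)⟩ : Bundle.TotalSpace (CModel n) B.E)) m₀ := by
  have hb₁ : ContMDiffAt I 𝓘(ℂ, CModel d) ω b₁ m₀ := (Bundle.contMDiffAt_totalSpace.1 hs).1
  exact ContMDiffAt.clm_apply_of_inCoordinates
    (ContMDiffAt.comp m₀ (B.holomorphic (b₁ m₀) (b₂ m₀)) (hb₁.prodMk hb₂)) hs hb₂

theorem contMDiffAt_functional {y : Y} (ℓ : B.E y →ₗ[ℂ] ℂ) {g : N → B.E y} {m₀ : N}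
    (hg : ContMDiffAt I (𝓘(ℂ, CModel d).prod 𝓘(ℂ, CModel n)) ω
      (fun m => (⟨y, g m⟩ : Bundle.TotalSpace (CModel n) B.E)) m₀) :
    ContMDiffAt I 𝓘(ℂ, ℂ) ω (fun m => ℓ (g m)) m₀ := by
  let ℓ' : CModel n →L[ℂ] ℂ :=
    LinearMap.toContinuousLinearMap (ℓ ∘ₗ (B.fiberEquiv y).symm.toLinearEquiv.toLinearMap)
  have h := ℓ'.contMDiff.contMDiffAt.comp m₀ (Bundle.contMDiffAt_totalSpace.1 hg).2
  refine h.congr_of_eventuallyEq (Filter.Eventually.of_forall fun m => ?_)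
  exact congrArg ℓ ((B.fiberEquiv y).symm_apply_apply (g m)).symm

end Holomorphic

/-- The space of sections spanned by the sections `v P(x, ·)`. It carries the quantization that
corresponds to the propagator. -/
def sections : Submodule ℂ (∀ y, B.E y) :=
  Submodule.span ℂ {s | ∃ (x : Y) (v : B.E x), s = fun y => B.P x y v}

/-- The section `v P(x, ·)`. -/
def kernelSection (x : Y) : B.E x →ₗ[ℂ] B.sections where
  toFun v := ⟨fun y => B.P x y v, Submodule.subset_span ⟨x, v, rfl⟩⟩
  map_add' v w := Subtype.ext (funext fun y => map_add (B.P x y) v w)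
  map_smul' c v := Subtype.ext (funext fun y => map_smul (B.P x y) c v)

/-- The evaluation of sections at a point. -/
def eval (y : Y) : B.sections →ₗ[ℂ] B.E y := LinearMap.proj y ∘ₗ B.sections.subtype

variable {B} in
@[simp]
theorem eval_kernelSection (x y : Y) (v : B.E x) : B.eval y (B.kernelSection x v) = B.P x y v :=
  rfl

theorem contMDiff_section (s : B.sections) :
    ContMDiff 𝓘(ℂ, CModel d) (𝓘(ℂ, CModel d).prod 𝓘(ℂ, CModel n)) ω
      (fun y => (⟨y, B.eval y s⟩ : Bundle.TotalSpace (CModel n) B.E)) := by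
  obtain ⟨s, hs⟩ := s
  change ContMDiff 𝓘(ℂ, CModel d) (𝓘(ℂ, CModel d).prod 𝓘(ℂ, CModel n)) ω
      (fun y => (⟨y, s y⟩ : Bundle.TotalSpace (CModel n) B.E))
  induction hs using Submodule.span_induction with
  | mem s hs =>
    obtain ⟨x, v, rfl⟩ := hs
    exact fun y => B.contMDiffAt_P contMDiffAt_const contMDiffAt_id
  | zero => exact Bundle.contMDiff_zeroSection ℂ B.E
  | add s t _ _ hs ht => exact hs.add_section ht
  | smul c s _ hs => exact hs.const_smul_section

theorem continuous_inner (s t : B.sections) :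
    Continuous fun y => (B.metric y).inner (B.eval y s) (B.eval y t) := by
  refine continuous_iff_continuousAt.2 fun y₀ => ?_
  let e := trivializationAt (CModel n) B.E y₀
  have he : e.baseSet ∈ nhds y₀ :=
    e.open_baseSet.mem_nhds (FiberBundle.mem_baseSet_trivializationAt' y₀)
  have hu (s : B.sections) : ContinuousAt (fun y => (e ⟨y, B.eval y s⟩).2) y₀ :=
    (Bundle.contMDiffAt_totalSpace.1 (B.contMDiff_section s y₀)).2.continuousAt
  have hui (s : B.sections) (i : Fin n) :
      ContinuousAt (fun y => (e ⟨y, B.eval y s⟩).2 i) y₀ :=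
    (EuclideanSpace.proj (𝕜 := ℂ) i).continuous.continuousAt.comp (hu s)
  have hsum : ContinuousAt (fun y => ∑ i, ∑ j,
      (starRingEnd ℂ) ((e ⟨y, B.eval y s⟩).2 i) * (e ⟨y, B.eval y t⟩).2 j *
      (B.metric y).inner (e.symm y (EuclideanSpace.single i 1))
        (e.symm y (EuclideanSpace.single j 1))) y₀ := by
    refine tendsto_finsetSum _ fun i _ => tendsto_finsetSum _ fun j _ => ?_
    exact ((Complex.continuous_conj.continuousAt.comp (hui s i)).mul (hui t j)).mul
      ((B.metric_smooth y₀ _ _).continuousOn.continuousAt he)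
  refine hsum.congr ?_
  filter_upwards [he] with y hy
  have hs (s : B.sections) : e.symmₗ ℂ y (e ⟨y, B.eval y s⟩).2 = B.eval y s := by
    rw [e.coe_symmₗ hy]
    exact e.symm_apply_apply_mk hy _
  rw [← hs s, ← hs t, InnerProductSpace.Core.inner_map_eq_sum, hs, hs, e.coe_symmₗ hy]

end HermitianPropagator

/-! ### The Hilbert space of a Hermitian propagator -/

namespace HermitianPropagator

variable (B : HermitianPropagator.{u, v, w} Ω ι n)

/-- Idempotency forces the volume of `M` to be finite: the functions `|v P(x, ·)|²` are continuous
and have non-zero integral. -/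
theorem isFiniteMeasure (B : HermitianPropagator.{u, v, w} Ω ι n) (hι : Continuous ι)
    (hn : n ≠ 0) : IsFiniteMeasure (Ω.measure ι) := by
  refine isFiniteMeasure_of_integral_ne_zero fun x => ?_
  have hpos : 0 < Module.finrank ℂ (B.E (ι x)) := by
    rw [B.finrank_fiber]
    exact Nat.pos_of_ne_zero hn
  have := Module.nontrivial_of_finrank_pos hpos
  obtain ⟨v, hv⟩ := exists_ne (0 : B.E (ι x))
  have hv' : (B.metric (ι x)).inner v v ≠ 0 := fun h => hv ((B.metric (ι x)).definite v h)
  let s := B.kernelSection (ι x) v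
  refine ⟨fun z => (B.metric (ι z)).inner (B.eval (ι z) s) (B.eval (ι z) s),
    (B.continuous_inner s s).comp hι, ?_, ?_⟩
  · simpa [s, B.normalized] using hv'
  · obtain ⟨c, -, hc⟩ := B.idempotent
    intro h
    have h1 := hc (ι x) (ι x) v ((B.metric (ι x)).functional v)
    simp only [InnerProductSpace.Core.functional_apply, B.normalized] at h1
    rw [← h1] at hv'
    refine hv' (mul_eq_zero_of_right _ (Eq.trans ?_ h))
    exact integral_congr_ae (Filter.Eventually.of_forall fun z => (B.hermitian x z v _).symm)

/-- The measure used to integrate sections over `M`. If the rank `n` is positive,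
idempotency makes `Ω.measure ι` finite; sections of a bundle of rank zero vanish, and the zero
measure serves as well. -/
def volume (_ : HermitianPropagator.{u, v, w} Ω ι n) : Measure M :=
  if n = 0 then 0 else Ω.measure ι

theorem isFiniteMeasure_volume (hι : Continuous ι) : IsFiniteMeasure B.volume := by
  rw [volume]
  split_ifs with hn
  · infer_instance
  · exact B.isFiniteMeasure hι hn

theorem subsingleton_fiber (hn : n = 0) (y : Y) : Subsingleton (B.E y) :=
  Module.finrank_zero_iff.1 ((B.finrank_fiber y).trans hn)

/-- The scale factor in the idempotency relation. -/
def scale : ℝ := Classical.choose B.idempotent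

theorem scale_pos : 0 < B.scale := (Classical.choose_spec B.idempotent).1

theorem integral_P (x y : Y) (v : B.E x) (ℓ : B.E y →ₗ[ℂ] ℂ) :
    (B.scale : ℂ) * ∫ z, ℓ (B.P (ι z) y (B.P x (ι z) v)) ∂B.volume = ℓ (B.P x y v) := by
  by_cases hn : n = 0
  · have := B.subsingleton_fiber hn
    have h (a : B.E y) : ℓ a = 0 := by rw [Subsingleton.elim a 0, map_zero]
    simp [h]
  · rw [volume, if_neg hn]
    exact (Classical.choose_spec B.idempotent).2 x y v ℓ

theorem integrable_of_continuous [BorelSpace M]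
    (hι : Continuous ι) {f : M → ℂ} (hf : Continuous f) :
    Integrable f B.volume := by
  have := B.isFiniteMeasure_volume hι
  exact hf.integrable_of_hasCompactSupport (HasCompactSupport.of_compactSpace f)

theorem continuous_functional_P (hι : Continuous ι) (s : B.sections) (y : Y)
    (ℓ : B.E y →ₗ[ℂ] ℂ) : Continuous fun z => ℓ (B.P (ι z) y (B.eval (ι z) s)) := by
  have h : Continuous fun x => ℓ (B.P x y (B.eval x s)) :=
    ContMDiff.continuous fun x =>
      B.contMDiffAt_functional ℓ (B.contMDiffAt_P (B.contMDiff_section s x) contMDiffAt_const)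
  exact h.comp hι

variable [BorelSpace M]

theorem integrable_inner (hι : Continuous ι) (s t : B.sections) : Integrable
    (fun z => (B.metric (ι z)).inner (B.eval (ι z) s) (B.eval (ι z) t)) B.volume :=
  B.integrable_of_continuous hι ((B.continuous_inner s t).comp hι)

/-- The reproducing property of the propagator: sections are determined by their restriction
to `M`. -/
theorem integral_eval (hι : Continuous ι) (s : B.sections) (y : Y) (ℓ : B.E y →ₗ[ℂ] ℂ) :
    (B.scale : ℂ) * ∫ z, ℓ (B.P (ι z) y (B.eval (ι z) s)) ∂B.volume = ℓ (B.eval y s) := by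
  obtain ⟨s, hs⟩ := s
  induction hs using Submodule.span_induction with
  | mem s hs =>
    obtain ⟨x, v, rfl⟩ := hs
    exact B.integral_P x y v ℓ
  | zero => simp [eval]
  | add s t hs' ht' hs ht =>
    have h := integral_add
      (B.integrable_of_continuous hι (B.continuous_functional_P hι ⟨s, hs'⟩ y ℓ))
      (B.integrable_of_continuous hι (B.continuous_functional_P hι ⟨t, ht'⟩ y ℓ))
    have hst (z : Y) : B.eval z ⟨s + t, Submodule.add_mem _ hs' ht'⟩ =
      B.eval z ⟨s, hs'⟩ + B.eval z ⟨t, ht'⟩ := rfl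
    simp only [hst, map_add]
    rw [h, mul_add, hs, ht]
  | smul a s hs' hs =>
    have has (z : Y) : B.eval z ⟨a • s, Submodule.smul_mem _ a hs'⟩ = a • B.eval z ⟨s, hs'⟩ := rfl
    simp only [has, map_smul, smul_eq_mul, integral_const_mul]
    rw [mul_left_comm, hs]

/-- The `L²` inner product over `M` on the space of sections. -/
abbrev sectionCore (hι : Continuous ι) : InnerProductSpace.Core ℂ B.sections where
  inner s t :=
    B.scale * ∫ z, (B.metric (ι z)).inner (B.eval (ι z) s) (B.eval (ι z) t) ∂B.volume
  conj_inner_symm s t := by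
    rw [map_mul, Complex.conj_ofReal, ← integral_conj]
    simp only [PreInnerProductSpace.Core.conj_inner_symm]
  re_inner_nonneg s := by
    have h := integral_re (B.integrable_inner hι s s)
    rw [RCLike.re_eq_complex_re, Complex.re_ofReal_mul]
    refine mul_nonneg B.scale_pos.le ?_
    refine le_of_le_of_eq ?_ h
    exact integral_nonneg fun z => (B.metric (ι z)).re_inner_nonneg _
  add_left s t r := by
    have h := integral_add
      (B.integrable_inner hι s r)
      (B.integrable_inner hι t r)
    simp only [map_add, PreInnerProductSpace.Core.add_left]
    rw [← mul_add]
    exact congrArg _ h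
  smul_left s t a := by
    simp only [map_smul, PreInnerProductSpace.Core.smul_left, integral_const_mul]
    ring
  definite s hs := by
    have hint := B.integrable_inner hι s s
    have h0 : ∫ z, ((B.metric (ι z)).inner (B.eval (ι z) s) (B.eval (ι z) s)).re ∂B.volume = 0 := by
      have h1 := (mul_eq_zero.1 hs).resolve_left (by exact_mod_cast B.scale_pos.ne')
      refine (integral_re hint).trans ?_
      rw [h1, map_zero]
    have hae := (integral_eq_zero_iff_of_nonneg
      (fun z => (B.metric (ι z)).re_inner_nonneg (B.eval (ι z) s)) hint.re).1 h0
    refine Subtype.ext (funext fun y => (Module.forall_dual_apply_eq_zero_iff ℂ _).1 fun ℓ => ?_)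
    refine (B.integral_eval hι s y ℓ).symm.trans (mul_eq_zero_of_right _ ?_)
    refine integral_eq_zero_of_ae ?_
    filter_upwards [hae] with z hz
    have hzero : B.eval (ι z) s = 0 := by
      refine (B.metric (ι z)).definite _ (Complex.ext hz ?_)
      have h2 := congrArg Complex.im
        ((B.metric (ι z)).conj_inner_symm (B.eval (ι z) s) (B.eval (ι z) s))
      simp only [Complex.conj_im] at h2
      rw [Complex.zero_im]
      linarith
    simp [hzero]

/-- Over `M`, the sections `v P(x, ·)` represent the evaluation of sections. -/
theorem inner_kernelSection (hι : Continuous ι) (x : M) (v : B.E (ι x)) (s : B.sections) :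
    (B.sectionCore hι).inner (B.kernelSection (ι x) v) s =
      (B.metric (ι x)).inner v (B.eval (ι x) s) := by
  refine Eq.trans ?_ (B.integral_eval hι s (ι x) ((B.metric (ι x)).functional v))
  simp only [InnerProductSpace.Core.functional_apply, ← B.hermitian]
  rfl

/-- An orthonormal family of sections satisfies `∑ |ψ_i(z)|² ≤ n` at all `z ∈ M`, since the
evaluation at `z` is an orthogonal projection of rank `n`. -/
theorem sum_inner_eval_le (hι : Continuous ι) {m : ℕ} (ψ : Fin m → B.sections)
    (hψ : ∀ s, ∑ i, ‖(B.sectionCore hι).inner (ψ i) s‖ ^ 2 ≤ ((B.sectionCore hι).inner s s).re)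
    (z : M) :
    ∑ i, ((B.metric (ι z)).inner (B.eval (ι z) (ψ i)) (B.eval (ι z) (ψ i))).re ≤ n := by
  obtain ⟨e, he1, he⟩ := (B.metric (ι z)).exists_parseval
  simp only [he]
  rw [Finset.sum_comm]
  have key (a : Fin (Module.finrank ℂ (B.E (ι z)))) :
      ∑ i, ‖(B.metric (ι z)).inner (e a) (B.eval (ι z) (ψ i))‖ ^ 2 ≤ 1 := by
    have h := hψ (B.kernelSection (ι z) (e a))
    rw [inner_kernelSection, eval_kernelSection, B.normalized, he1, Complex.one_re] at h
    refine le_of_eq_of_le (Finset.sum_congr rfl fun i _ => ?_) h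
    rw [← B.inner_kernelSection hι, ← (B.sectionCore hι).conj_inner_symm, RCLike.norm_conj]
  refine (Finset.sum_le_sum fun a _ => key a).trans ?_
  simp [B.finrank_fiber]

/-- The space of sections is finite-dimensional: its dimension is at most `n` times the rescaled
volume of `M`. -/
theorem finiteDimensional_sections (hι : Continuous ι) : FiniteDimensional ℂ B.sections := by
  have hfin := B.isFiniteMeasure_volume hι
  refine (B.sectionCore hι).finiteDimensional_of_bessel
    (B.scale * (n * B.volume.real Set.univ)) fun m ψ hψ1 hψ => ?_
  have hint (i : Fin m) :=
    B.integrable_inner hι (ψ i) (ψ i)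
  have h1 (i : Fin m) : B.scale * ∫ z, ((B.metric (ι z)).inner (B.eval (ι z) (ψ i))
      (B.eval (ι z) (ψ i))).re ∂B.volume = 1 := by
    have h := congrArg Complex.re (hψ1 i)
    rw [Complex.one_re] at h
    rw [← h]
    refine Eq.trans ?_ (Complex.re_ofReal_mul _ _).symm
    exact congrArg _ (integral_re (hint i))
  have h2 : (m : ℝ) = B.scale * ∫ z, ∑ i, ((B.metric (ι z)).inner (B.eval (ι z) (ψ i))
      (B.eval (ι z) (ψ i))).re ∂B.volume := by
    have h := integral_finsetSum Finset.univ fun i _ => (hint i).re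
    simp only [RCLike.re_eq_complex_re] at h
    rw [h, Finset.mul_sum]
    simp [h1]
  rw [h2]
  refine mul_le_mul_of_nonneg_left ?_ B.scale_pos.le
  calc ∫ z, ∑ i, ((B.metric (ι z)).inner (B.eval (ι z) (ψ i)) (B.eval (ι z) (ψ i))).re ∂B.volume
      ≤ ∫ _, (n : ℝ) ∂B.volume :=
        integral_mono (integrable_finsetSum _ fun i _ => (hint i).re) (integrable_const _)
          (B.sum_inner_eval_le hι ψ hψ)
    _ = n * B.volume.real Set.univ := by simp [mul_comm]

end HermitianPropagator

/-! ### The quantization of a Hermitian propagator -/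

namespace HermitianPropagator

/-- A morphism of Hermitian propagators whose inverse is holomorphic is an isomorphism. -/
def Hom.toIso {B B' : HermitianPropagator.{u, v, w} Ω ι n} (f : Hom B B')
    (hf : ContMDiff (𝓘(ℂ, CModel d).prod 𝓘(ℂ, CModel n)) (𝓘(ℂ, CModel d).prod 𝓘(ℂ, CModel n)) ω
      (fun p : Bundle.TotalSpace (CModel n) B'.E =>
        (⟨p.1, (f.f p.1).symm p.2⟩ : Bundle.TotalSpace (CModel n) B.E))) : B ≅ B' where
  hom := f
  inv :=
    { f := fun y => (f.f y).symm
      holomorphic := hf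
      unitary := fun x v w => by simp [← f.unitary]
      conj := fun x y v => by simp [LinearEquiv.eq_symm_apply, ← f.conj] }
  hom_inv_id := Hom.ext (funext fun y => LinearEquiv.self_trans_symm (f.f y))
  inv_hom_id := Hom.ext (funext fun y => LinearEquiv.symm_trans_self (f.f y))

variable (B : HermitianPropagator.{u, v, w} Ω ι n) [BorelSpace M] (hι : Continuous ι)

/-- The Hilbert space of the quantization: a Euclidean space of the dimension of the space of
sections, in the universe of the fibres of the bundle. -/
abbrev Model : Type w := EuclideanSpace ℂ (ULift.{w} (Fin (Module.finrank ℂ B.sections)))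

/-- An isometry from the space of sections, with the `L²` inner product over `M`, to its model. -/
def toModel : B.sections ≃ₗ[ℂ] B.Model :=
  have := B.finiteDimensional_sections hι
  Classical.choose (B.sectionCore hι).exists_linearEquiv_euclideanSpace.{w}

theorem inner_toModel (s t : B.sections) :
    ⟪B.toModel hι s, B.toModel hι t⟫_ℂ = (B.sectionCore hι).inner s t :=
  have := B.finiteDimensional_sections hι
  Classical.choose_spec (B.sectionCore hι).exists_linearEquiv_euclideanSpace.{w} s t

/-- The evaluation of sections at `y`, on the model of the space of sections. -/
def modelEval (y : Y) : B.Model →ₗ[ℂ] B.E y := B.eval y ∘ₗ (B.toModel hι).symm.toLinearMap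

/-- The map `v ↦ v P(y, ·)`, to the model of the space of sections. -/
def modelKernel (y : Y) : B.E y →ₗ[ℂ] B.Model := (B.toModel hι).toLinearMap ∘ₗ B.kernelSection y

@[simp]
theorem modelEval_modelKernel (x y : Y) (v : B.E x) :
    B.modelEval hι y (B.modelKernel hι x v) = B.P x y v := by
  simp [modelEval, modelKernel]

theorem inner_modelKernel (x : M) (v : B.E (ι x)) (ψ : B.Model) :
    ⟪B.modelKernel hι (ι x) v, ψ⟫_ℂ = (B.metric (ι x)).inner v (B.modelEval hι (ι x) ψ) := by
  obtain ⟨s, rfl⟩ := (B.toModel hι).surjective ψ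
  simp only [modelKernel, modelEval, LinearMap.comp_apply, LinearEquiv.coe_coe,
    LinearEquiv.symm_apply_apply]
  rw [inner_toModel, inner_kernelSection]

theorem inner_model (ψ φ : B.Model) : ⟪ψ, φ⟫_ℂ = (B.scale : ℂ) *
    ∫ z, (B.metric (ι z)).inner (B.modelEval hι (ι z) ψ) (B.modelEval hι (ι z) φ) ∂B.volume := by
  obtain ⟨s, rfl⟩ := (B.toModel hι).surjective ψ
  obtain ⟨t, rfl⟩ := (B.toModel hι).surjective φ
  simp only [modelEval, LinearMap.comp_apply, LinearEquiv.coe_coe,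
    LinearEquiv.symm_apply_apply]
  rw [inner_toModel]
  rfl

/-- The sections `v P(x, ·)` with `x ∈ M` span the space of sections. -/
theorem span_modelKernel : Submodule.span ℂ
    {ψ : B.Model | ∃ (x : M) (v : B.E (ι x)), ψ = B.modelKernel hι (ι x) v} = ⊤ := by
  rw [← Submodule.orthogonal_eq_bot_iff, Submodule.eq_bot_iff]
  intro ψ hψ
  have h0 (x : M) : B.modelEval hι (ι x) ψ = 0 := by
    refine (B.metric (ι x)).definite _ ?_
    rw [← B.inner_modelKernel hι]
    exact hψ _ (Submodule.subset_span ⟨x, _, rfl⟩)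
  rw [← inner_self_eq_zero (𝕜 := ℂ), B.inner_model hι]
  simp only [h0]
  simp only [← InnerProductSpace.Core.functional_apply, map_zero, integral_zero, mul_zero]

section Holomorphic

variable {E N K : Type*} [NormedAddCommGroup E] [NormedSpace ℂ E] [TopologicalSpace K]
  {I : ModelWithCorners ℂ E K} [TopologicalSpace N] [ChartedSpace K N]

/-- The matrix elements of `v P(x, ·)` with the spanning sections `w P(z, ·)`, `z ∈ M`, are
`⟨w, v P(x, z)⟩`, which is holomorphic in `x` and `v`. -/
theorem contMDiffAt_modelKernel {b : N → Y} {s : ∀ m, B.E (b m)} {m₀ : N}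
    (hs : ContMDiffAt I (𝓘(ℂ, CModel d).prod 𝓘(ℂ, CModel n)) ω
      (fun m => (⟨b m, s m⟩ : Bundle.TotalSpace (CModel n) B.E)) m₀) :
    ContMDiffAt I 𝓘(ℂ, B.Model) ω (fun m => B.modelKernel hι (b m) (s m)) m₀ := by
  refine contMDiffAt_of_inner (B.span_modelKernel hι) ?_
  rintro _ ⟨x, v, rfl⟩
  simp only [inner_modelKernel, modelEval_modelKernel]
  exact B.contMDiffAt_functional ((B.metric (ι x)).functional v)
    (B.contMDiffAt_P hs contMDiffAt_const)

theorem contMDiffAt_modelEval {b : N → Y} {ψ : N → B.Model} {m₀ : N}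
    (hb : ContMDiffAt I 𝓘(ℂ, CModel d) ω b m₀) (hψ : ContMDiffAt I 𝓘(ℂ, B.Model) ω ψ m₀) :
    ContMDiffAt I (𝓘(ℂ, CModel d).prod 𝓘(ℂ, CModel n)) ω
      (fun m => (⟨b m, B.modelEval hι (b m) (ψ m)⟩ : Bundle.TotalSpace (CModel n) B.E)) m₀ := by
  refine Bundle.contMDiffAt_totalSpace.2 ⟨hb, ?_⟩
  let e := trivializationAt (CModel n) B.E (b m₀)
  let u := stdOrthonormalBasis ℂ B.Model
  have h : ContMDiffAt I 𝓘(ℂ, CModel n) ω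
      (fun m => ∑ i, ⟪u i, ψ m⟫_ℂ • (e ⟨b m, B.modelEval hι (b m) (u i)⟩).2) m₀ := by
    refine ContMDiffAt.sum fun i _ => ?_
    have h1 : ContMDiffAt I 𝓘(ℂ, ℂ) ω (fun m => ⟪u i, ψ m⟫_ℂ) m₀ :=
      (innerSL ℂ (u i)).contMDiff.contMDiffAt.comp m₀ hψ
    have h2 : ContMDiffAt I 𝓘(ℂ, CModel n) ω
        (fun m => (e ⟨b m, B.modelEval hι (b m) (u i)⟩).2) m₀ :=
      (Bundle.contMDiffAt_totalSpace.1
        (ContMDiffAt.comp m₀ (B.contMDiff_section ((B.toModel hι).symm (u i)) (b m₀)) hb)).2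
    exact h1.smul h2
  refine h.congr_of_eventuallyEq ?_
  filter_upwards [hb.continuousAt.eventually_mem
    (e.open_baseSet.mem_nhds (FiberBundle.mem_baseSet_trivializationAt' (b m₀)))] with m hm
  have hL (v : B.E (b m)) : (e ⟨b m, v⟩).2 = e.linearMapAt ℂ (b m) v := by
    rw [e.coe_linearMapAt_of_mem hm]
  change (e ⟨b m, _⟩).2 = _
  simp only [hL]
  conv_lhs => rw [← u.sum_repr' (ψ m)]
  simp only [map_sum, map_smul]

end Holomorphic

/-- The quantization of points defined by a Hermitian propagator: `q(y) ψ = ψ(y) P(y, ·)` on the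
space of sections. -/
def toQuantization : PointQuantization.{u, v, w} Ω ι n where
  H := B.Model
  q y := LinearMap.toContinuousLinearMap (B.modelKernel hι y ∘ₗ B.modelEval hι y)
  mem y := by
    constructor
    · ext1 ψ
      change B.modelKernel hι y (B.modelEval hι y (B.modelKernel hι y _)) = _
      rw [modelEval_modelKernel, B.normalized]
      rfl
    · have hinj : Function.Injective (B.modelKernel hι y) := fun v w h => by
        have := congrArg (B.modelEval hι y) h
        simpa only [modelEval_modelKernel, B.normalized] using this
      have hsurj : Function.Surjective (B.modelEval hι y) := fun v =>
        ⟨B.modelKernel hι y v, by rw [modelEval_modelKernel, B.normalized]⟩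
      change Module.rank ℂ (LinearMap.range (B.modelKernel hι y ∘ₗ B.modelEval hι y)) = n
      rw [LinearMap.range_comp_of_range_eq_top _ (LinearMap.range_eq_top.2 hsurj),
        ← (LinearEquiv.ofInjective _ hinj).rank_eq, ← Module.finrank_eq_rank, B.finrank_fiber]
  holomorphic y := by
    refine contMDiffAt_clm_of_apply (B.span_modelKernel hι) fun ψ _ => ?_
    exact B.contMDiffAt_modelKernel hι (B.contMDiffAt_modelEval hι contMDiffAt_id contMDiffAt_const)
  hermitian x := by
    rw [ContinuousLinearMap.isSelfAdjoint_iff_isSymmetric]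
    intro ψ φ
    change ⟪B.modelKernel hι (ι x) (B.modelEval hι (ι x) ψ), φ⟫_ℂ =
      ⟪ψ, B.modelKernel hι (ι x) (B.modelEval hι (ι x) φ)⟫_ℂ
    rw [inner_modelKernel, ← inner_conj_symm, inner_modelKernel]
    exact ((B.metric (ι x)).conj_inner_symm _ _).symm
  overcomplete := by
    refine ⟨B.scale, B.scale_pos, fun ψ φ => ?_⟩
    have key (x : M) : ⟪ψ, B.modelKernel hι (ι x) (B.modelEval hι (ι x) φ)⟫_ℂ =
        (B.metric (ι x)).inner (B.modelEval hι (ι x) ψ) (B.modelEval hι (ι x) φ) := by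
      rw [← inner_conj_symm, inner_modelKernel]
      exact (B.metric (ι x)).conj_inner_symm _ _
    change ⟪ψ, φ⟫_ℂ = (B.scale : ℂ) *
      ∫ x, ⟪ψ, B.modelKernel hι (ι x) (B.modelEval hι (ι x) φ)⟫_ℂ ∂(Ω.measure ι)
    simp only [key]
    rw [B.inner_model hι]
    -- For `n = 0` the measures `B.volume` and `Ω.measure ι` differ, but all fibres vanish.
    by_cases hn : n = 0
    · have h0 (x : M) : (B.metric (ι x)).inner (B.modelEval hι (ι x) ψ)
          (B.modelEval hι (ι x) φ) = 0 := by
        have := B.subsingleton_fiber hn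
        rw [Subsingleton.elim (B.modelEval hι (ι x) φ) 0]
        exact map_zero ((B.metric (ι x)).functional _)
      simp [h0]
    · rw [volume, if_neg hn]

theorem toQuantization_q (y : Y) (ψ : B.Model) :
    (B.toQuantization hι).q y ψ = B.modelKernel hι y (B.modelEval hι y ψ) := rfl

theorem toQuantization_q_modelKernel (x y : Y) (v : B.E x) :
    (B.toQuantization hι).q y (B.modelKernel hι x v) = B.modelKernel hι y (B.P x y v) := by
  rw [toQuantization_q, modelEval_modelKernel]

/-- The fibre over `y` of a propagator is isomorphic to the range of the projection `q y` of its
quantization. -/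
def quantizationFiberEquiv (y : Y) : B.E y ≃ₗ[ℂ] (B.toQuantization hι).Fiber y where
  toFun v := ⟨B.modelKernel hι y v, B.modelKernel hι y v, by
    refine (B.toQuantization_q_modelKernel hι y y v).trans ?_
    rw [B.normalized]⟩
  invFun ψ := B.modelEval hι y ψ.1
  map_add' v w := Subtype.ext (map_add (B.modelKernel hι y) v w)
  map_smul' c v := Subtype.ext (map_smul (B.modelKernel hι y) c v)
  left_inv v := (B.modelEval_modelKernel hι y y v).trans (B.normalized y v)
  right_inv ψ := Subtype.ext (PointQuantization.q_fiber ψ)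

/-- The isomorphism of a propagator with the propagator of its quantization. -/
def toPropagatorHom : Hom B ((B.toQuantization hι).toPropagator hι) where
  f := B.quantizationFiberEquiv hι
  holomorphic p := by
    refine (B.toQuantization hι).contMDiffAt_totalSpace_iff.2 ⟨Bundle.contMDiffAt_proj _, ?_⟩
    exact B.contMDiffAt_modelKernel hι (s := fun p : Bundle.TotalSpace (CModel n) B.E => p.2)
      contMDiffAt_id
  unitary x v w := by
    refine (B.inner_modelKernel hι x v (B.modelKernel hι (ι x) w)).trans ?_
    rw [modelEval_modelKernel, B.normalized]
  conj x y v := Subtype.ext (B.toQuantization_q_modelKernel hι x y v)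

/-- Every Hermitian propagator is isomorphic to the propagator of its quantization. -/
def toPropagatorIso : B ≅ (PointQuantization.propagatorFunctor hι).obj (B.toQuantization hι) :=
  (B.toPropagatorHom hι).toIso fun p => B.contMDiffAt_modelEval hι (Bundle.contMDiffAt_proj _)
    ((B.toQuantization hι).contMDiff_coe p)

end HermitianPropagator

instance [BorelSpace M] (hι : Continuous ι) :
    (PointQuantization.propagatorFunctor.{u, v, w} (Ω := Ω) (n := n) hι).EssSurj where
  mem_essImage B := ⟨B.toQuantization hι, ⟨(B.toPropagatorIso hι).symm⟩⟩

end Quantization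

end

theorem mainTheorem1 {d : ℕ}
    {Y : Type u} [TopologicalSpace Y] [T2Space Y] [SecondCountableTopology Y]
    [ChartedSpace (CModel d) Y] [IsManifold 𝓘(ℂ, CModel d) ω Y]
    {M : Type v} [TopologicalSpace M] [T2Space M] [CompactSpace M]
    [ChartedSpace (RModel d) M] [IsManifold 𝓘(ℝ, RModel d) ∞ M]
    [MeasurableSpace M] [BorelSpace M]
    (Ω : HolomorphicVolumeForm d Y) (ι : M → Y) (hι : IsVolumeCycle Ω ι) (n : ℕ) :
    ∃ e : PointQuantization.{u, v, w} Ω ι n ≌ HermitianPropagator.{u, v, w} Ω ι n,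
      (∀ Q y₁ y₂ y₃, (e.functor.obj Q).threePoint y₁ y₂ y₃ = Q.threePoint y₁ y₂ y₃) ∧
      (∀ B y₁ y₂ y₃, (e.inverse.obj B).threePoint y₁ y₂ y₃ = B.threePoint y₁ y₂ y₃) ∧
      (∀ Q, Function.Injective Q.q ↔ (e.functor.obj Q).SeparatesPoints) ∧
      (∀ Q, (∀ x y, x ≠ y → Disjoint (LinearMap.range (Q.q x : Q.H →ₗ[ℂ] Q.H))
          (LinearMap.range (Q.q y : Q.H →ₗ[ℂ] Q.H))) ↔
        (e.functor.obj Q).SeparatesVectors) := by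
  have hc : Continuous ι := hι.embedding.isEmbedding.continuous
  have : (PointQuantization.propagatorFunctor.{u, v, w} (Ω := Ω) (n := n) hc).IsEquivalence := {}
  let e := (PointQuantization.propagatorFunctor.{u, v, w} (Ω := Ω) (n := n) hc).asEquivalence
  refine ⟨e, fun Q => Q.threePoint_toPropagator hc, fun B y₁ y₂ y₃ => ?_,
    fun Q => Q.injective_iff_separatesPoints hc, fun Q => Q.disjoint_iff_separatesVectors hc⟩
  exact ((e.inverse.obj B).threePoint_toPropagator hc y₁ y₂ y₃).symm.trans
    ((e.counit.app B).threePoint_eq y₁ y₂ y₃)
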